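/- Let $\mathbb K=\mathbb R$ or $\mathbb C$, with coordinates $(x,y)$ on $\mathbb K^2$; "smooth" means $C^\infty$ if $\mathbb K=\mathbb R$ and holomorphic if $\mathbb K=\mathbb C$. Let $d\ge 3$. **The connection of a $d$-web.** A $d$-web on an open set $V\subseteq\mathbb K^2$ given by first integrals is a family $u_1,\dots,u_d$ of smooth functions on $V$ whose differentials are pairwise linearly independent at every point of $V$. It has slopes $m_1,\dots,m_d$ if $\partial_xu_i+m_i\,\partial_yu_i=0$ for all $i$, i.e. if the leaves of the $i$-th foliation are the trajectories of $\partial_x+m_i\,\partial_y$. Differentiate the relation $\sum_i h_i(u_i)=0$ and write $\omega_i^s=h_i^{(s)}(u_i)$. The derivatives of order $k$, listed as $\partial_x^k,\partial_x^{k-1}\partial_y,\dots,\partial_y^k$, give linear equations in the $\omega_i^s$, $1\le i\le d$, $1\le s\le k$. The equations of orders $1,\dots,d-2$ define a subbundle $E$ of rank $(d-1)(d-2)/2$ of the trivial bundle with fibre coordinates $\omega_i^s$, $1\le i\le d$, $1\le s\le d-2$. Those of order $d-1$ express $\omega^{d-1}=(\omega^{d-1}_i)_i$ through the $\omega^s$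 with $s\le d-2$. With this value of $\omega^{d-1}$, put $(\Delta_x\omega)_i^s=(\partial_xu_i)\,\omega_i^{s+1}$ and $(\Delta_y\omega)_i^s=(\partial_yu_i)\,\omega_i^{s+1}$ for $1\le s\le d-2$. The connection $\nabla$ associated with the web is the restriction to $E$ of $\partial_x-\Delta_x$, $\partial_y-\Delta_y$. Let $(e_i^r)$, $1\le r\le d-2$, $r+2\le i\le d$, be the basis of $E$ for which the coordinates $\omega_j^s$ with $j\ge s+2$ of $e_i^r$ are all $0$, except $\omega_i^r=1$, and let $\Omega_x,\Omega_y$ be the matrices with $\nabla_x e=\Omega_x e$, $\nabla_y e=\Omega_y e$. The curvature of $\nabla$ has the matrix $$K=\partial_y\Omega_x-\partial_x\Omega_y+\Omega_x\Omega_y-\Omega_y\Omega_x .$$ A web on $U$ that is given only by its slopes, or by a differential equation for its leaves, is called *flat* on $U$ if every point of $U$ has an open neighbourhood $V\subseteq U$ on which the web is given by first integrals with $K=0$ on $V$. **Decomposability.** A function $R$ is *decomposable* on a set if there $R(x,y)=X(x)Y(y)$ for functions $X,Y$ of one variable; it is *locally decomposable* on $U$ if it is decomposable in a neighbourhood of every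 point of $U$. **Lemma.** Let $U\subseteq\mathbb K^2$ be open, let $R:U\to\mathbb K$ be smooth without zeros, let $\lambda_1,\dots,\lambda_d\in\mathbb K$ be pairwise distinct constants, and consider the $d$-web with slopes $m_i=R(x,y)\lambda_i$. Then: 1. whenever $u_1,\dots,u_d$ are first integrals of this web on the whole of $U$, their curvature $K$ vanishes on $U$ if and only if $R$ is locally decomposable on $U$; 2. the web is flat on $U$ if and only if $R$ is locally decomposable on $U$; 3. if moreover $U=I\times J$ with $I,J\subseteq\mathbb K$ connected (or empty), then the web is flat on $U$ if and only if $R$ is decomposable on $U$. **Corollary (Hénaut's conjecture for $F=(y')^d+f(x,y)$).** Let $U\subseteq\mathbb C^2$ be open, let $f:U\to\mathbb C$ be holomorphic without zeros, and consider the $d$-web on $U$ whose leaves are the solutions of $(y')^d+f(x,y)=0$. Then: 1. whenever $u_1,\dots,u_d$ are first integrals of this web on the whole of $U$, their curvature $K$ vanishes on $U$ if and only if $f$ is locally decomposable on $U$; 2. the web is flat on $U$ if and only if $f$ is locally decomposable on $U$; 3. if moreover $U=I\times J$ with $I,J\subseteq\mathbb C$ connected (or empty), then the web is flat on $U$ if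 and only if $f$ is decomposable on $U$. -/

import Mathlib

open scoped ContDiff Matrix Topology

namespace PlanarWeb

noncomputable section

/-- The partial derivative with respect to the first coordinate `x`. -/
def pdx {𝕜 : Type*} [RCLike 𝕜] (g : 𝕜 × 𝕜 → 𝕜) (z : 𝕜 × 𝕜) : 𝕜 :=
  fderiv 𝕜 g z (1, 0)

/-- The partial derivative with respect to the second coordinate `y`. -/
def pdy {𝕜 : Type*} [RCLike 𝕜] (g : 𝕜 × 𝕜 → 𝕜) (z : 𝕜 × 𝕜) : 𝕜 :=
  fderiv 𝕜 g z (0, 1)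

/-- A `d`-web on `U` given by first integrals `u i`: these are smooth (holomorphic if `𝕜 = ℂ`), and
the foliations by their level curves are pairwise transverse at every point of `U`. -/
structure IsWeb {𝕜 : Type*} [RCLike 𝕜] {d : ℕ} (U : Set (𝕜 × 𝕜))
    (u : Fin d → 𝕜 × 𝕜 → 𝕜) : Prop where
  smooth : ∀ i, ContDiffOn 𝕜 ∞ (u i) U
  transverse : ∀ z ∈ U, ∀ i j, i ≠ j →
    pdx (u i) z * pdy (u j) z - pdy (u i) z * pdx (u j) z ≠ 0

/-- The web `u` on `U` has slopes `m i`: the `i`-th foliation consists of the trajectories of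
`∂/∂x + m i ∂/∂y`. -/
def HasSlopes {𝕜 : Type*} [RCLike 𝕜] {d : ℕ} (m : Fin d → 𝕜 × 𝕜 → 𝕜) (U : Set (𝕜 × 𝕜))
    (u : Fin d → 𝕜 × 𝕜 → 𝕜) : Prop :=
  IsWeb U u ∧ ∀ z ∈ U, ∀ i, pdx (u i) z + m i z * pdy (u i) z = 0

/-- The leaves of the web `u` on `U` are solutions of the differential equation
`F(x, y, y') = 0`, polynomial in `y'`. By transversality the `d` slopes at a point are distinct, so
that they are all the roots when `F` has degree `d` in `y'`. -/
def SolvesImplicit {𝕜 : Type*} [RCLike 𝕜] {d : ℕ} (F : 𝕜 × 𝕜 → Polynomial 𝕜)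
    (U : Set (𝕜 × 𝕜)) (u : Fin d → 𝕜 × 𝕜 → 𝕜) : Prop :=
  IsWeb U u ∧ ∀ z ∈ U, ∀ i, ∃ p : 𝕜, (F z).IsRoot p ∧ pdx (u i) z + p * pdy (u i) z = 0

/-- The coefficients of the chain rule in two variables: for every function `h` of one variable,
`∂_x^a ∂_y^b (h ∘ g) = ∑ s, chainCoeff g a b s * (h^(s) ∘ g)`. -/
def chainCoeff {𝕜 : Type*} [RCLike 𝕜] (g : 𝕜 × 𝕜 → 𝕜) : ℕ → ℕ → ℕ → 𝕜 × 𝕜 → 𝕜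
  | 0, 0, 0 => fun _ => 1
  | 0, 0, _ + 1 => fun _ => 0
  | 0, b + 1, 0 => pdy (chainCoeff g 0 b 0)
  | 0, b + 1, s + 1 => fun z =>
      pdy (chainCoeff g 0 b (s + 1)) z + pdy g z * chainCoeff g 0 b s z
  | a + 1, b, 0 => pdx (chainCoeff g a b 0)
  | a + 1, b, s + 1 => fun z =>
      pdx (chainCoeff g a b (s + 1)) z + pdx g z * chainCoeff g a b s z

theorem chainCoeff_of_lt {𝕜 : Type*} [RCLike 𝕜] (g : 𝕜 × 𝕜 → 𝕜) (a b s : ℕ) (h : a + b < s) :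
    chainCoeff g a b s = fun _ => 0 := by
  induction a generalizing s with
  | zero =>
    induction b generalizing s with
    | zero =>
      obtain ⟨s, rfl⟩ : ∃ t, s = t + 1 := ⟨s - 1, by omega⟩
      funext z
      simp [chainCoeff]
    | succ b ih =>
      obtain ⟨s, rfl⟩ : ∃ t, s = t + 1 := ⟨s - 1, by omega⟩
      funext z
      simp [chainCoeff, ih (s + 1) (by omega), ih s (by omega), pdy]
  | succ a ih =>
    obtain ⟨s, rfl⟩ : ∃ t, s = t + 1 := ⟨s - 1, by omega⟩
    funext z
    simp [chainCoeff, ih (s + 1) (by omega), ih s (by omega), pdx]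

theorem chainCoeff_top {𝕜 : Type*} [RCLike 𝕜] (g : 𝕜 × 𝕜 → 𝕜) (a b : ℕ) :
    chainCoeff g a b (a + b) = fun z => pdx g z ^ a * pdy g z ^ b := by
  induction a with
  | zero =>
    induction b with
    | zero => funext z; simp [chainCoeff]
    | succ b ih =>
      funext z
      rw [show 0 + (b + 1) = b + 1 from by omega]
      rw [Nat.zero_add] at ih
      simp [chainCoeff, ih, chainCoeff_of_lt g 0 b (b + 1) (by omega), pdy, pow_succ, mul_comm]
  | succ a ih =>
    funext z
    rw [show a + 1 + b = (a + b) + 1 from by omega]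
    simp [chainCoeff, ih, chainCoeff_of_lt g a b (a + b + 1) (by omega), pdx, pow_succ]
    ring

/-- The matrix `G_r^j`, the coefficient of `(ω_i^(r-j))_i` in the derivatives of order `r - 1` of
the relation `∑ h_i(u_i) = 0`, where `ω_i^s = h_i^(s)(u_i)`. The row `a` corresponds to
`∂_x^(r-1-a) ∂_y^a`. -/
def blockG {𝕜 : Type*} [RCLike 𝕜] {d : ℕ} (u : Fin d → 𝕜 × 𝕜 → 𝕜) (r j : ℕ) (z : 𝕜 × 𝕜) :
    Matrix (Fin r) (Fin d) 𝕜 :=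
  Matrix.of fun a i => chainCoeff (u i) (r - 1 - a) a (r - j) z

/-- The matrix `P_r = G_r^1`, the coefficient of `(ω_i^(r-1))_i` in the derivatives of order
`r - 1`. -/
def blockP {𝕜 : Type*} [RCLike 𝕜] {d : ℕ} (u : Fin d → 𝕜 × 𝕜 → 𝕜) (r : ℕ) (z : 𝕜 × 𝕜) :
    Matrix (Fin r) (Fin d) 𝕜 :=
  blockG u r 1 z

/-- The columns of `P_r` consist of the monomials of degree `r - 1` in the first derivatives. -/
theorem blockP_apply {𝕜 : Type*} [RCLike 𝕜] {d : ℕ} (u : Fin d → 𝕜 × 𝕜 → 𝕜) (r : ℕ)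
    (z : 𝕜 × 𝕜) (a : Fin r) (i : Fin d) :
    blockP u r z a i = pdx (u i) z ^ (r - 1 - (a : ℕ)) * pdy (u i) z ^ (a : ℕ) := by
  have h : r - 1 = (r - 1 - (a : ℕ)) + a := by omega
  have := congrFun (chainCoeff_top (u i) (r - 1 - a) a) z
  rw [← h] at this
  simpa [blockP, blockG] using this

/-- The matrix `A_j = - P_d⁻¹ G_d^j`. -/
def coeffA {𝕜 : Type*} [RCLike 𝕜] {d : ℕ} (u : Fin d → 𝕜 × 𝕜 → 𝕜) (j : ℕ) (z : 𝕜 × 𝕜) :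
    Matrix (Fin d) (Fin d) 𝕜 :=
  -((blockP u d z)⁻¹ * blockG u d j z)

/-- The index `(r, i)` stands for the coordinate `ω_(i+1)^(r+1)` of the trivial bundle of rank
`(d - 2) d`. -/
abbrev Idx (d : ℕ) : Type := Fin (d - 2) × Fin d

/-- The pivot indices. They also number the derivatives of orders `1, …, d - 2`: the order `r + 1`
has the `r + 2` derivatives `∂_x^(r+1-a) ∂_y^a`, `a < r + 2`. -/
abbrev PivotIdx (d : ℕ) : Type := {p : Idx d // (p.2 : ℕ) < (p.1 : ℕ) + 2}

/-- The remaining `(d - 1) (d - 2) / 2` indices, those of the free coordinates `β`. -/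
abbrev FreeIdx (d : ℕ) : Type := {p : Idx d // ¬ (p.2 : ℕ) < (p.1 : ℕ) + 2}

/-- The block lower triangular matrix `MM`, of the derivatives of orders `1, …, d - 2` of
`∑ h_i(u_i) = 0`. Its kernel is the bundle that carries the connection of the web. -/
def matMM {𝕜 : Type*} [RCLike 𝕜] {d : ℕ} (u : Fin d → 𝕜 × 𝕜 → 𝕜) (z : 𝕜 × 𝕜) :
    Matrix (PivotIdx d) (Idx d) 𝕜 :=
  Matrix.of fun p q =>
    if (q.1 : ℕ) ≤ (p.1.1 : ℕ) then
      blockG u ((p.1.1 : ℕ) + 2) ((p.1.1 : ℕ) + 1 - (q.1 : ℕ)) z ⟨(p.1.2 : ℕ), p.2⟩ q.2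
    else 0

/-- The square matrix whose rows are those of `MM` and the free coordinates. -/
def completedMM {𝕜 : Type*} [RCLike 𝕜] {d : ℕ} (u : Fin d → 𝕜 × 𝕜 → 𝕜) (z : 𝕜 × 𝕜) :
    Matrix (Idx d) (Idx d) 𝕜 :=
  Matrix.of fun p q =>
    if h : (p.2 : ℕ) < (p.1 : ℕ) + 2 then matMM u z ⟨p, h⟩ q else if p = q then 1 else 0

/-- The vector `e_p` of the basis of the kernel of `MM`: the element of the kernel whose free
coordinates are all `0`, except the coordinate `p`, which is `1`. -/
def kerBasis {𝕜 : Type*} [RCLike 𝕜] {d : ℕ} (u : Fin d → 𝕜 × 𝕜 → 𝕜) (z : 𝕜 × 𝕜)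
    (p : FreeIdx d) : Idx d → 𝕜 :=
  (completedMM u z)⁻¹ *ᵥ Pi.single p.1 1

theorem kerBasis_spec {𝕜 : Type*} [RCLike 𝕜] {d : ℕ} (u : Fin d → 𝕜 × 𝕜 → 𝕜) (z : 𝕜 × 𝕜)
    (h : IsUnit (completedMM u z).det) (p : FreeIdx d) :
    matMM u z *ᵥ kerBasis u z p = 0 ∧
      ∀ q : FreeIdx d, kerBasis u z p q.1 = if q = p then 1 else 0 := by
  have key : completedMM u z *ᵥ kerBasis u z p = Pi.single p.1 1 := by
    rw [kerBasis, Matrix.mulVec_mulVec, Matrix.mul_nonsing_inv _ h, Matrix.one_mulVec]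
  constructor
  · funext q
    have hq := congrFun key q.1
    have hne : q.1 ≠ p.1 := fun e => p.2 (e ▸ q.2)
    rw [Pi.single_eq_of_ne hne] at hq
    simpa [Matrix.mulVec, dotProduct, completedMM, q.2] using hq
  · intro q
    have hq := congrFun key q.1
    have h2 := q.2
    simp only [Matrix.mulVec, dotProduct, completedMM, Matrix.of_apply, dif_neg h2, ite_mul,
      one_mul, zero_mul, Finset.sum_ite_eq, Finset.mem_univ, if_true] at hq
    rw [hq, Pi.single_apply]
    simp [Subtype.ext_iff]

/-- The matrix `Δ`: it expresses the prolonged system `∂_x ω_i^s = (∂_x u_i) ω_i^(s+1)`,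
`∂_y ω_i^s = (∂_y u_i) ω_i^(s+1)`, where `ω^(d-1)` has been eliminated by the derivatives of order
`d - 1` of `∑ h_i(u_i) = 0`. -/
def matDelta {𝕜 : Type*} [RCLike 𝕜] {d : ℕ} (u : Fin d → 𝕜 × 𝕜 → 𝕜) (z : 𝕜 × 𝕜) :
    Matrix (Idx d) (Idx d) 𝕜 :=
  Matrix.of fun p q =>
    if (p.1 : ℕ) + 1 < d - 2 then
      if (p.1 : ℕ) + 1 = (q.1 : ℕ) ∧ p.2 = q.2 then 1 else 0
    else coeffA u (d - 1 - (q.1 : ℕ)) z p.2 q.2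

/-- `Δ_x = DD_x Δ`. -/
def deltaX {𝕜 : Type*} [RCLike 𝕜] {d : ℕ} (u : Fin d → 𝕜 × 𝕜 → 𝕜) (z : 𝕜 × 𝕜) :
    Matrix (Idx d) (Idx d) 𝕜 :=
  Matrix.diagonal (fun p => pdx (u p.2) z) * matDelta u z

/-- `Δ_y = DD_y Δ`. -/
def deltaY {𝕜 : Type*} [RCLike 𝕜] {d : ℕ} (u : Fin d → 𝕜 × 𝕜 → 𝕜) (z : 𝕜 × 𝕜) :
    Matrix (Idx d) (Idx d) 𝕜 :=
  Matrix.diagonal (fun p => pdy (u p.2) z) * matDelta u z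

/-- The connection `∇` of the web is the restriction of `∂_x - Δ_x`, `∂_y - Δ_y` to the kernel of
`MM`. As the free coordinates of `e_p` are constant, `∇_x e_p = ∑ q, Ω_x p q • e_q`, where
`Ω_x p q` is the free coordinate `q` of `- Δ_x e_p`. -/
def omegaX {𝕜 : Type*} [RCLike 𝕜] {d : ℕ} (u : Fin d → 𝕜 × 𝕜 → 𝕜) (z : 𝕜 × 𝕜) :
    Matrix (FreeIdx d) (FreeIdx d) 𝕜 :=
  Matrix.of fun p q => -(deltaX u z *ᵥ kerBasis u z p) q.1

/-- The matrix of `∇_y`, with the conventions of `omegaX`. -/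
def omegaY {𝕜 : Type*} [RCLike 𝕜] {d : ℕ} (u : Fin d → 𝕜 × 𝕜 → 𝕜) (z : 𝕜 × 𝕜) :
    Matrix (FreeIdx d) (FreeIdx d) 𝕜 :=
  Matrix.of fun p q => -(deltaY u z *ᵥ kerBasis u z p) q.1

/-- The curvature matrix `K = ∂_y Ω_x - ∂_x Ω_y + Ω_x Ω_y - Ω_y Ω_x` of the connection `∇` in the
basis `e`. Since `∇ e = Ω e` (basis vectors number the rows), `[∇_y, ∇_x] e = K e`. -/
def curvature {𝕜 : Type*} [RCLike 𝕜] {d : ℕ} (u : Fin d → 𝕜 × 𝕜 → 𝕜) (z : 𝕜 × 𝕜) :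
    Matrix (FreeIdx d) (FreeIdx d) 𝕜 :=
  (Matrix.of fun p q =>
    pdy (fun w => omegaX u w p q) z - pdx (fun w => omegaY u w p q) z) +
  (omegaX u z * omegaY u z - omegaY u z * omegaX u z)

/-- Flatness on `U` of a web that need not have first integrals on the whole of `U`; `IsPres V u`
says that the functions `u i` are first integrals for it on `V`. Near each point of `U` the
curvature, computed with first integrals, vanishes. -/
def IsFlat {𝕜 : Type*} [RCLike 𝕜] {d : ℕ}
    (IsPres : Set (𝕜 × 𝕜) → (Fin d → 𝕜 × 𝕜 → 𝕜) → Prop) (U : Set (𝕜 × 𝕜)) : Prop :=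
  ∀ z₀ ∈ U, ∃ V : Set (𝕜 × 𝕜), IsOpen V ∧ z₀ ∈ V ∧ V ⊆ U ∧
    ∃ u : Fin d → 𝕜 × 𝕜 → 𝕜, IsPres V u ∧ ∀ z ∈ V, curvature u z = 0

/-- `R(x, y) = X(x) Y(y)` on `U`. (If `R` is smooth without zeros, then so are `X` and `Y`.) -/
def IsDecomposable {𝕜 : Type*} [RCLike 𝕜] (R : 𝕜 × 𝕜 → 𝕜) (U : Set (𝕜 × 𝕜)) : Prop :=
  ∃ X Y : 𝕜 → 𝕜, ∀ z ∈ U, R z = X z.1 * Y z.2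

/-- `R` is decomposable in a neighbourhood of every point of `U`. -/
def IsLocallyDecomposable {𝕜 : Type*} [RCLike 𝕜] (R : 𝕜 × 𝕜 → 𝕜) (U : Set (𝕜 × 𝕜)) : Prop :=
  ∀ z₀ ∈ U, ∃ V ∈ 𝓝 z₀, IsDecomposable R V

end

end PlanarWeb

namespace PlanarWeb

variable {𝕜 : Type*} [RCLike 𝕜]

/-! Both local decomposability and vanishing of the curvature are equivalent to `∂_x ∂_y (log R) =
0`, written without logarithms as `MixedLogVanishes`.

If `K = 0`, take traces. The commutator contributes nothing, and only the diagonal entries of `Ω_x`,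
`Ω_y` are needed. By `HasSlopes.matDelta_mulVec_kerBasis_self` these depend only on the chain rule
coefficients one below the top order, and a Vandermonde argument (`subtop_moments`) solves for them.
The contributions of the chosen first integrals cancel, so that `trace K` is a nonzero constant
times `∂_x ∂_y (log R)` (`HasSlopes.trace_curvature`).

Conversely, if the mixed derivative vanishes, there are local coordinates `s(x)`, `t(y)` in which
the web consists of parallel lines `t - l_i s = const` (`MixedLogVanishes.exists_potentials`).
Whenever `c` kills the moments of `l` of orders up to `m`, the sum `∑ c_i (t - l_i s)^m` is zero.
These abelian relations are horizontal sections of `∇`, even when they are expressed through other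
first integrals `u_i`. The curvature annihilates their jets, which at a given point form a
triangular basis of the fibre of `E`; hence `K = 0` (`HasSlopes.curvature_eq_zero`).

For `(y')^d + f = 0` the ratios of the slopes are `d`-th roots of unity, hence locally constant.
Locally the web has slopes `R l_i` with `f = -R^d`, and the logarithmic derivative of `f` is `d`
times that of `R`. -/

/-- The derivative in the constant direction `e`. -/
noncomputable def pd (e : 𝕜 × 𝕜) (g : 𝕜 × 𝕜 → 𝕜) (z : 𝕜 × 𝕜) : 𝕜 :=
  fderiv 𝕜 g z e

theorem pdx_eq_pd : (pdx : (𝕜 × 𝕜 → 𝕜) → 𝕜 × 𝕜 → 𝕜) = pd (1, 0) := rfl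

theorem pdy_eq_pd : (pdy : (𝕜 × 𝕜 → 𝕜) → 𝕜 × 𝕜 → 𝕜) = pd (0, 1) := rfl

theorem ContDiffOn.differentiableAt_of_isOpen {U : Set (𝕜 × 𝕜)} (hU : IsOpen U)
    {g : 𝕜 × 𝕜 → 𝕜} (hg : ContDiffOn 𝕜 ∞ g U) {z : 𝕜 × 𝕜} (hz : z ∈ U) :
    DifferentiableAt 𝕜 g z :=
  (hg.contDiffAt (hU.mem_nhds hz)).differentiableAt (by simp)

/-! ### Calculus of directional derivatives -/

section Rules

variable (e : 𝕜 × 𝕜) {f g : 𝕜 × 𝕜 → 𝕜} {z : 𝕜 × 𝕜}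

@[simp] theorem pd_const (c : 𝕜) : pd e (fun _ => c) z = 0 := by
  simp [pd]

theorem pd_add (hf : DifferentiableAt 𝕜 f z) (hg : DifferentiableAt 𝕜 g z) :
    pd e (fun w => f w + g w) z = pd e f z + pd e g z := by
  simp [pd, fderiv_fun_add hf hg]

theorem pd_sub (hf : DifferentiableAt 𝕜 f z) (hg : DifferentiableAt 𝕜 g z) :
    pd e (fun w => f w - g w) z = pd e f z - pd e g z := by
  simp [pd, fderiv_fun_sub hf hg]

theorem pd_neg : pd e (fun w => -f w) z = -pd e f z := by
  simp [pd, fderiv_fun_neg]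

theorem pd_mul (hf : DifferentiableAt 𝕜 f z) (hg : DifferentiableAt 𝕜 g z) :
    pd e (fun w => f w * g w) z = pd e f z * g z + f z * pd e g z := by
  simp [pd, fderiv_fun_mul hf hg]
  ring

theorem pd_const_mul (c : 𝕜) (hf : DifferentiableAt 𝕜 f z) :
    pd e (fun w => c * f w) z = c * pd e f z := by
  rw [pd_mul e (differentiableAt_const c) hf]
  simp

theorem pd_pow (hf : DifferentiableAt 𝕜 f z) (n : ℕ) :
    pd e (fun w => f w ^ n) z = n * f z ^ (n - 1) * pd e f z := by
  simp [pd, fderiv_fun_pow n hf]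

theorem pd_div (hf : DifferentiableAt 𝕜 f z) (hg : DifferentiableAt 𝕜 g z) (h0 : g z ≠ 0) :
    pd e (fun w => f w / g w) z = (pd e f z * g z - f z * pd e g z) / g z ^ 2 := by
  -- The quotient rule is solved from the product rule for `(f / g) * g`, which equals `f` only near
  -- `z`, where `g` has no zeros.
  have h1 : DifferentiableAt 𝕜 (fun w => f w / g w) z := by
    simpa only [div_eq_mul_inv] using hf.fun_mul (hg.fun_inv h0)
  have h2 := pd_mul e h1 hg
  have h3 : (fun w => f w / g w * g w) =ᶠ[𝓝 z] f := by
    filter_upwards [hg.continuousAt.eventually_ne h0] with w hw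
    field_simp
  have h4 : pd e (fun w => f w / g w * g w) z = pd e f z := by
    simp only [pd, h3.fderiv_eq]
  rw [h4] at h2
  rw [h2]
  field_simp
  ring

theorem pd_sum {ι : Type*} (s : Finset ι) {F : ι → 𝕜 × 𝕜 → 𝕜}
    (hF : ∀ i ∈ s, DifferentiableAt 𝕜 (F i) z) :
    pd e (fun w => ∑ i ∈ s, F i w) z = ∑ i ∈ s, pd e (F i) z := by
  simp [pd, fderiv_fun_sum hF]

theorem pd_congr {U : Set (𝕜 × 𝕜)} (hU : IsOpen U) (h : Set.EqOn f g U) (hz : z ∈ U) :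
    pd e f z = pd e g z := by
  have : f =ᶠ[𝓝 z] g := Filter.eventuallyEq_of_mem (hU.mem_nhds hz) h
  simp only [pd, this.fderiv_eq]

theorem contDiffOn_pd {U : Set (𝕜 × 𝕜)} (hU : IsOpen U) (hg : ContDiffOn 𝕜 ∞ g U) :
    ContDiffOn 𝕜 ∞ (pd e g) U :=
  (hg.fderiv_of_isOpen hU (m := ∞) (by simp)).clm_apply contDiffOn_const

theorem pd_comm {U : Set (𝕜 × 𝕜)} (hU : IsOpen U) (hg : ContDiffOn 𝕜 ∞ g U) (hz : z ∈ U)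
    (e' : 𝕜 × 𝕜) : pd e (pd e' g) z = pd e' (pd e g) z := by
  have hat : ContDiffAt 𝕜 ∞ g z := hg.contDiffAt (hU.mem_nhds hz)
  have hs : IsSymmSndFDerivAt 𝕜 g z := hat.isSymmSndFDerivAt (by
    rw [minSmoothness_of_isRCLikeNormedField]; exact WithTop.coe_le_coe.2 le_top)
  have hd : DifferentiableAt 𝕜 (fderiv 𝕜 g) z :=
    (hat.fderiv_right (m := ∞) (by simp)).differentiableAt (by simp)
  have key : ∀ a b : 𝕜 × 𝕜, pd a (pd b g) z = fderiv 𝕜 (fderiv 𝕜 g) z a b := by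
    intro a b
    change fderiv 𝕜 (fun w => fderiv 𝕜 g w b) z a = _
    rw [fderiv_clm_apply hd (differentiableAt_const b)]
    simp
  rw [key, key]
  exact hs e e'

end Rules

/-! ### The chain rule coefficients and differentiated relations -/

section ChainCoeff

theorem chainCoeff_zero_succ_zero (g : 𝕜 × 𝕜 → 𝕜) (b : ℕ) :
    chainCoeff g 0 (b + 1) 0 = pd (0, 1) (chainCoeff g 0 b 0) := by
  rw [chainCoeff]; rfl

theorem chainCoeff_zero_succ_succ (g : 𝕜 × 𝕜 → 𝕜) (b s : ℕ) :
    chainCoeff g 0 (b + 1) (s + 1) = fun z =>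
      pd (0, 1) (chainCoeff g 0 b (s + 1)) z + pd (0, 1) g z * chainCoeff g 0 b s z := by
  rw [chainCoeff]; rfl

theorem chainCoeff_succ_zero (g : 𝕜 × 𝕜 → 𝕜) (a b : ℕ) :
    chainCoeff g (a + 1) b 0 = pd (1, 0) (chainCoeff g a b 0) := by
  rw [chainCoeff]; rfl

theorem chainCoeff_succ_succ (g : 𝕜 × 𝕜 → 𝕜) (a b s : ℕ) :
    chainCoeff g (a + 1) b (s + 1) = fun z =>
      pd (1, 0) (chainCoeff g a b (s + 1)) z + pd (1, 0) g z * chainCoeff g a b s z := by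
  rw [chainCoeff]; rfl

variable {U : Set (𝕜 × 𝕜)} {g : 𝕜 × 𝕜 → 𝕜}

theorem contDiffOn_chainCoeff (hU : IsOpen U) (hg : ContDiffOn 𝕜 ∞ g U) (a b s : ℕ) :
    ContDiffOn 𝕜 ∞ (chainCoeff g a b s) U := by
  induction a generalizing s with
  | zero =>
    induction b generalizing s with
    | zero => cases s <;> rw [chainCoeff] <;> exact contDiffOn_const
    | succ b ih =>
      cases s with
      | zero => rw [chainCoeff_zero_succ_zero]; exact contDiffOn_pd _ hU (ih 0)
      | succ s =>
        rw [chainCoeff_zero_succ_succ]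
        exact (contDiffOn_pd _ hU (ih (s + 1))).add ((contDiffOn_pd _ hU hg).mul (ih s))
  | succ a ih =>
    cases s with
    | zero => rw [chainCoeff_succ_zero]; exact contDiffOn_pd _ hU (ih 0)
    | succ s =>
      rw [chainCoeff_succ_succ]
      exact (contDiffOn_pd _ hU (ih (s + 1))).add ((contDiffOn_pd _ hU hg).mul (ih s))

theorem chainCoeff_zero_right (g : 𝕜 × 𝕜 → 𝕜) (a b : ℕ) (h : 0 < a + b) :
    chainCoeff g a b 0 = fun _ => 0 := by
  have hb : ∀ b, chainCoeff g 0 (b + 1) 0 = fun _ => 0 := by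
    intro b
    induction b with
    | zero => funext z; simp [chainCoeff, pdy]
    | succ b ih => rw [chainCoeff, ih]; funext z; simp [pdy]
  induction a with
  | zero =>
    obtain ⟨b, rfl⟩ : ∃ c, b = c + 1 := ⟨b - 1, by omega⟩
    exact hb b
  | succ a ih =>
    rcases Nat.eq_zero_or_pos (a + b) with h0 | h0
    · obtain ⟨rfl, rfl⟩ : a = 0 ∧ b = 0 := by omega
      funext z; simp [chainCoeff, pdx]
    · rw [chainCoeff, ih h0]; funext z; simp [pdx]

/-- One step of the chain rule: if `W (s + 1)` is the derivative of `W s` with respect to `g`, then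
differentiating `∑ s, chainCoeff g a b s * W s` amounts to raising `a` or `b` by one. -/
theorem pd_sum_chainCoeff (hU : IsOpen U) (hg : ContDiffOn 𝕜 ∞ g U)
    {W : ℕ → 𝕜 × 𝕜 → 𝕜} (hW : ∀ s, ContDiffOn 𝕜 ∞ (W s) U) (e : 𝕜 × 𝕜)
    (hWe : ∀ s, ∀ z ∈ U, pd e (W s) z = pd e g z * W (s + 1) z) {a b a' b' : ℕ}
    (hab : a' + b' = a + b + 1) (h0 : chainCoeff g a' b' 0 = pd e (chainCoeff g a b 0))
    (hs : ∀ s, chainCoeff g a' b' (s + 1) = fun z =>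
      pd e (chainCoeff g a b (s + 1)) z + pd e g z * chainCoeff g a b s z)
    {z : 𝕜 × 𝕜} (hz : z ∈ U) :
    pd e (fun w => ∑ s ∈ Finset.range (a + b + 1), chainCoeff g a b s w * W s w) z =
      ∑ s ∈ Finset.range (a' + b' + 1), chainCoeff g a' b' s z * W s z := by
  have hD : ∀ s, DifferentiableAt 𝕜 (W s) z := fun s =>
    ContDiffOn.differentiableAt_of_isOpen hU (hW s) hz
  have hC : ∀ s, DifferentiableAt 𝕜 (chainCoeff g a b s) z := fun s =>
    ContDiffOn.differentiableAt_of_isOpen hU (contDiffOn_chainCoeff hU hg a b s) hz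
  rw [pd_sum e _ fun s _ => (hC s).fun_mul (hD s)]
  rw [Finset.sum_congr rfl fun s _ => pd_mul e (hC s) (hD s)]
  rw [Finset.sum_congr rfl fun s _ => by rw [hWe s z hz]]
  rw [Finset.sum_add_distrib, hab, Finset.sum_range_succ' _ (a + b + 1), h0]
  simp only [hs, add_mul, Finset.sum_add_distrib]
  rw [Finset.sum_range_succ' _ (a + b),
    Finset.sum_range_succ (fun s => pd e (chainCoeff g a b (s + 1)) z * W (s + 1) z) (a + b)]
  -- After the index shift one sum has an extra top term; it is the derivative of a coefficient that
  -- is identically zero.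
  rw [chainCoeff_of_lt g a b (a + b + 1) (by omega)]
  simp only [pd_const, zero_mul, add_zero]
  rw [add_right_comm]
  congr 2
  exact Finset.sum_congr rfl fun s _ => by ring

/-- A relation `∑ i, W 0 i = 0` between functions of the `u i` can be differentiated arbitrarily
often. -/
theorem sum_chainCoeff_eq_zero {ι : Type*} [Fintype ι] (hU : IsOpen U) {u : ι → 𝕜 × 𝕜 → 𝕜}
    (hu : ∀ i, ContDiffOn 𝕜 ∞ (u i) U) {W : ℕ → ι → 𝕜 × 𝕜 → 𝕜}
    (hW : ∀ s i, ContDiffOn 𝕜 ∞ (W s i) U)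
    (hx : ∀ s i, ∀ z ∈ U, pd (1, 0) (W s i) z = pd (1, 0) (u i) z * W (s + 1) i z)
    (hy : ∀ s i, ∀ z ∈ U, pd (0, 1) (W s i) z = pd (0, 1) (u i) z * W (s + 1) i z)
    (h0 : ∀ z ∈ U, ∑ i, W 0 i z = 0) (a b : ℕ) :
    ∀ z ∈ U, ∑ i, ∑ s ∈ Finset.range (a + b + 1), chainCoeff (u i) a b s z * W s i z = 0 := by
  have hd : ∀ a b i, ∀ z ∈ U, DifferentiableAt 𝕜 (fun w =>
      ∑ s ∈ Finset.range (a + b + 1), chainCoeff (u i) a b s w * W s i w) z := fun a b i z hz =>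
    ContDiffOn.differentiableAt_of_isOpen hU (ContDiffOn.sum fun s _ =>
      (contDiffOn_chainCoeff hU (hu i) a b s).mul (hW s i)) hz
  have step : ∀ (e : 𝕜 × 𝕜) (a b : ℕ), (∀ z ∈ U, ∑ i, ∑ s ∈ Finset.range (a + b + 1),
      chainCoeff (u i) a b s z * W s i z = 0) → ∀ z ∈ U, ∑ i, pd e (fun w =>
      ∑ s ∈ Finset.range (a + b + 1), chainCoeff (u i) a b s w * W s i w) z = 0 := by
    intro e a b h z hz
    rw [← pd_sum e _ fun i _ => hd a b i z hz, pd_congr e hU (g := fun _ => 0) h hz, pd_const]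
  -- The recursion of `chainCoeff` applies all `y`-derivatives first, so `b` is exhausted at `a =
  -- 0`.
  induction a with
  | zero =>
    induction b with
    | zero => intro z hz; simpa [chainCoeff] using h0 z hz
    | succ b ih =>
      intro z hz
      rw [← step (0, 1) 0 b ih z hz]
      exact Finset.sum_congr rfl fun i _ => (pd_sum_chainCoeff hU (hu i) (hW · i) (0, 1) (hy · i)
        (by omega) (chainCoeff_zero_succ_zero _ b) (chainCoeff_zero_succ_succ _ b) hz).symm
  | succ a ih =>
    intro z hz
    rw [← step (1, 0) a b ih z hz]
    exact Finset.sum_congr rfl fun i _ => (pd_sum_chainCoeff hU (hu i) (hW · i) (1, 0) (hx · i)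
      (by omega) (chainCoeff_succ_zero _ a b) (chainCoeff_succ_succ _ a b) hz).symm

end ChainCoeff

/-! ### Decomposability and the mixed logarithmic derivative -/

/-- The equation `R R_xy = R_x R_y`, that is `∂_x ∂_y (log R) = 0`. -/
def MixedLogVanishes (R : 𝕜 × 𝕜 → 𝕜) (U : Set (𝕜 × 𝕜)) : Prop :=
  ∀ z ∈ U, R z * pd (1, 0) (pd (0, 1) R) z = pd (1, 0) R z * pd (0, 1) R z

section Slices

/-- No differentiability is required: at a point where `f` is not differentiable, `fderiv` has the
default value `0`. -/
theorem pd_eq_deriv_line (e : 𝕜 × 𝕜) {f : 𝕜 × 𝕜 → 𝕜} {z : 𝕜 × 𝕜}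
    (h : ∀ t : 𝕜, f (z + t • e) = f z) : pd e f z = 0 := by
  by_cases hf : DifferentiableAt 𝕜 f z
  · rw [pd, ← hf.lineDeriv_eq_fderiv, lineDeriv]
    simp [h]
  · rw [pd, fderiv_zero_of_not_differentiableAt hf]
    rfl

theorem pd_snd_comp_fst (h : 𝕜 → 𝕜) (z : 𝕜 × 𝕜) : pd (0, 1) (fun w => h w.1) z = 0 :=
  pd_eq_deriv_line _ fun t => by simp

theorem pd_fst_comp_snd (h : 𝕜 → 𝕜) (z : 𝕜 × 𝕜) : pd (1, 0) (fun w => h w.2) z = 0 :=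
  pd_eq_deriv_line _ fun t => by simp

theorem hasDerivAt_slice_fst {F : 𝕜 × 𝕜 → 𝕜} {x y : 𝕜} (hF : DifferentiableAt 𝕜 F (x, y)) :
    HasDerivAt (fun t => F (t, y)) (pd (1, 0) F (x, y)) x :=
  HasFDerivAt.comp_hasDerivAt x hF.hasFDerivAt ((hasDerivAt_id x).prodMk (hasDerivAt_const x y))

theorem hasDerivAt_slice_snd {F : 𝕜 × 𝕜 → 𝕜} {x y : 𝕜} (hF : DifferentiableAt 𝕜 F (x, y)) :
    HasDerivAt (fun t => F (x, t)) (pd (0, 1) F (x, y)) y :=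
  HasFDerivAt.comp_hasDerivAt y hF.hasFDerivAt ((hasDerivAt_const y x).prodMk (hasDerivAt_id y))

end Slices

section Decomposable

variable {U : Set (𝕜 × 𝕜)} {R : 𝕜 × 𝕜 → 𝕜}

/-- This rectangle identity replaces the factors `X`, `Y`, about whose regularity nothing is known,
by values of `R`. -/
theorem IsDecomposable.cross {V : Set (𝕜 × 𝕜)} (h : IsDecomposable R V) {x y x' y' : 𝕜}
    (h1 : (x, y) ∈ V) (h2 : (x', y') ∈ V) (h3 : (x, y') ∈ V) (h4 : (x', y) ∈ V) :
    R (x, y) * R (x', y') = R (x, y') * R (x', y) := by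
  obtain ⟨X, Y, hXY⟩ := h
  rw [hXY _ h1, hXY _ h2, hXY _ h3, hXY _ h4]
  ring

theorem IsDecomposable.isLocallyDecomposable (hU : IsOpen U) (h : IsDecomposable R U) :
    IsLocallyDecomposable R U :=
  fun _ hz => ⟨U, hU.mem_nhds hz, h⟩

theorem MixedLogVanishes.pd_logDeriv_fst (hU : IsOpen U) (hR : ContDiffOn 𝕜 ∞ R U)
    (h0 : ∀ z ∈ U, R z ≠ 0) (h : MixedLogVanishes R U) :
    ∀ z ∈ U, pd (0, 1) (fun w => pd (1, 0) R w / R w) z = 0 := by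
  intro z hz
  rw [pd_div _ (ContDiffOn.differentiableAt_of_isOpen hU (contDiffOn_pd _ hU hR) hz)
    (ContDiffOn.differentiableAt_of_isOpen hU hR hz) (h0 z hz), pd_comm _ hU hR hz, mul_comm,
    h z hz, sub_self, zero_div]

theorem pd_logDeriv_snd (hU : IsOpen U) (hR : ContDiffOn 𝕜 ∞ R U) {z : 𝕜 × 𝕜} (hz : z ∈ U)
    (h0 : R z ≠ 0) : pd (1, 0) (fun w => pd (0, 1) R w / R w) z = 0 ↔
      R z * pd (1, 0) (pd (0, 1) R) z = pd (1, 0) R z * pd (0, 1) R z := by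
  rw [pd_div _ (ContDiffOn.differentiableAt_of_isOpen hU (contDiffOn_pd _ hU hR) hz)
    (ContDiffOn.differentiableAt_of_isOpen hU hR hz) h0, div_eq_zero_iff,
    or_iff_left (pow_ne_zero 2 h0), sub_eq_zero]
  rw [mul_comm, mul_comm (pd (0, 1) R z)]

/-- The equation is integrated twice: `R_x / R` does not depend on `y`, so `R(x, y) / R(x, y')` has
derivative zero in `x`. Connectedness of `J` is used for the first statement and that of `I` for the
second. -/
theorem MixedLogVanishes.cross (hU : IsOpen U) (hR : ContDiffOn 𝕜 ∞ R U)
    (h0 : ∀ z ∈ U, R z ≠ 0) (h : MixedLogVanishes R U) {I J : Set 𝕜} (hI : IsPreconnected I)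
    (hJ : IsPreconnected J) (hIo : IsOpen I) (hJo : IsOpen J) (hIJ : I ×ˢ J ⊆ U)
    {x y x' y' : 𝕜} (hx : x ∈ I) (hy : y ∈ J) (hx' : x' ∈ I) (hy' : y' ∈ J) :
    R (x, y) * R (x', y') = R (x, y') * R (x', y) := by
  have mem : ∀ {p q}, p ∈ I → q ∈ J → (p, q) ∈ U := fun hp hq => hIJ ⟨hp, hq⟩
  have dR : ∀ {z}, z ∈ U → DifferentiableAt 𝕜 R z := fun hz =>
    ContDiffOn.differentiableAt_of_isOpen hU hR hz
  have dL : ∀ {z}, z ∈ U → DifferentiableAt 𝕜 (fun w => pd (1, 0) R w / R w) z := fun hz =>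
    ContDiffOn.differentiableAt_of_isOpen hU ((contDiffOn_pd _ hU hR).div hR h0) hz
  have h1 : ∀ p ∈ I, pd (1, 0) R (p, y) / R (p, y) = pd (1, 0) R (p, y') / R (p, y') := by
    intro p hp
    have hd : ∀ q ∈ J, HasDerivAt (fun q => pd (1, 0) R (p, q) / R (p, q)) 0 q := fun q hq => by
      have := hasDerivAt_slice_snd (dL (mem hp hq))
      rwa [h.pd_logDeriv_fst hU hR h0 _ (mem hp hq)] at this
    exact hJo.is_const_of_deriv_eq_zero hJ
      (fun q hq => (hd q hq).differentiableAt.differentiableWithinAt)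
      (fun q hq => (hd q hq).deriv) hy hy'
  have h2 : R (x, y) / R (x, y') = R (x', y) / R (x', y') := by
    have hd : ∀ p ∈ I, HasDerivAt (fun p => R (p, y) / R (p, y')) 0 p := fun p hp => by
      have e1 := h0 _ (mem hp hy)
      have e2 := h0 _ (mem hp hy')
      have := (hasDerivAt_slice_fst (dR (mem hp hy))).div
        (hasDerivAt_slice_fst (dR (mem hp hy'))) e2
      have e := h1 p hp
      rw [div_eq_div_iff e1 e2] at e
      exact this.congr_deriv (by rw [e]; ring)
    exact hIo.is_const_of_deriv_eq_zero hI
      (fun q hq => (hd q hq).differentiableAt.differentiableWithinAt)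
      (fun q hq => (hd q hq).deriv) hx hx'
  rw [div_eq_div_iff (h0 _ (mem hx hy')) (h0 _ (mem hx' hy'))] at h2
  rw [h2]
  ring

theorem MixedLogVanishes.isDecomposable (hU : IsOpen U) (hR : ContDiffOn 𝕜 ∞ R U)
    (h0 : ∀ z ∈ U, R z ≠ 0) (h : MixedLogVanishes R U) {I J : Set 𝕜} (hI : IsPreconnected I)
    (hJ : IsPreconnected J) (hIo : IsOpen I) (hJo : IsOpen J) (hIJ : I ×ˢ J ⊆ U) :
    IsDecomposable R (I ×ˢ J) := by
  rcases (I ×ˢ J).eq_empty_or_nonempty with he | ⟨⟨x', y'⟩, hx', hy'⟩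
  · exact ⟨0, 0, by simp [he]⟩
  -- The factors are the slices of `R` through a base point, normalised so that the base value is
  -- counted once.
  · refine ⟨fun x => R (x, y'), fun y => R (x', y) / R (x', y'), ?_⟩
    rintro ⟨x, y⟩ ⟨hx, hy⟩
    have h1 := h.cross hU hR h0 hI hJ hIo hJo hIJ hx hy hx' hy'
    rw [← mul_div_assoc, ← h1, mul_div_cancel_right₀ _ (h0 _ (hIJ ⟨hx', hy'⟩))]

/-- Every open subset of the plane contains a product of discs around each of its points. -/
theorem exists_ball_prod_subset (hU : IsOpen U) {z : 𝕜 × 𝕜} (hz : z ∈ U) :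
    ∃ r > 0, Metric.ball z.1 r ×ˢ Metric.ball z.2 r ⊆ U := by
  obtain ⟨r, hr, h⟩ := Metric.isOpen_iff.1 hU z hz
  exact ⟨r, hr, by rwa [ball_prod_same]⟩

theorem isPreconnected_ball (x : 𝕜) (r : ℝ) : IsPreconnected (Metric.ball x r) :=
  (convex_ball x r).isPreconnected

theorem MixedLogVanishes.isLocallyDecomposable (hU : IsOpen U) (hR : ContDiffOn 𝕜 ∞ R U)
    (h0 : ∀ z ∈ U, R z ≠ 0) (h : MixedLogVanishes R U) : IsLocallyDecomposable R U := by
  intro z hz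
  obtain ⟨r, hr, hV⟩ := exists_ball_prod_subset hU hz
  exact ⟨_, prod_mem_nhds (Metric.ball_mem_nhds _ hr) (Metric.ball_mem_nhds _ hr),
    h.isDecomposable hU hR h0 (isPreconnected_ball _ _) (isPreconnected_ball _ _)
      Metric.isOpen_ball Metric.isOpen_ball hV⟩

/-- The given factors cannot be differentiated. On a box `B` the rectangle identity gives `R = G H /
R(z)` with the slices `G`, `H` of `R`, which are smooth and depend on one variable each. -/
theorem IsLocallyDecomposable.mixedLogVanishes (hU : IsOpen U) (hR : ContDiffOn 𝕜 ∞ R U)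
    (h0 : ∀ z ∈ U, R z ≠ 0) (h : IsLocallyDecomposable R U) : MixedLogVanishes R U := by
  intro z hz
  obtain ⟨V, hV, hdec⟩ := h z hz
  obtain ⟨V', hV'V, hV'o, hzV'⟩ := mem_nhds_iff.1 hV
  obtain ⟨r, hr, hB⟩ := exists_ball_prod_subset (hU.inter hV'o) ⟨hz, hzV'⟩
  set B := Metric.ball z.1 r ×ˢ Metric.ball z.2 r with hBdef
  have hBo : IsOpen B := Metric.isOpen_ball.prod Metric.isOpen_ball
  have hz1 : z.1 ∈ Metric.ball z.1 r := Metric.mem_ball_self hr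
  have hz2 : z.2 ∈ Metric.ball z.2 r := Metric.mem_ball_self hr
  have hzB : z ∈ B := ⟨hz1, hz2⟩
  have hBU : B ⊆ U := fun w hw => (hB hw).1
  have hBV : B ⊆ V := fun w hw => hV'V (hB hw).2
  have hG : ContDiffOn 𝕜 ∞ (fun w : 𝕜 × 𝕜 => R (w.1, z.2)) B :=
    hR.comp (contDiff_fst.prodMk contDiff_const).contDiffOn fun w hw => hBU ⟨hw.1, hz2⟩
  have hH : ContDiffOn 𝕜 ∞ (fun w : 𝕜 × 𝕜 => R (z.1, w.2)) B :=
    hR.comp (contDiff_const.prodMk contDiff_snd).contDiffOn fun w hw => hBU ⟨hz1, hw.2⟩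
  set G : 𝕜 × 𝕜 → 𝕜 := fun w => R (w.1, z.2)
  set H : 𝕜 × 𝕜 → 𝕜 := fun w => R (z.1, w.2)
  have dG : ∀ w ∈ B, DifferentiableAt 𝕜 G w := fun w hw =>
    ContDiffOn.differentiableAt_of_isOpen hBo hG hw
  have dH : ∀ w ∈ B, DifferentiableAt 𝕜 H w := fun w hw =>
    ContDiffOn.differentiableAt_of_isOpen hBo hH hw
  have dH' : ∀ w ∈ B, DifferentiableAt 𝕜 (pd (0, 1) H) w := fun w hw =>
    ContDiffOn.differentiableAt_of_isOpen hBo (contDiffOn_pd _ hBo hH) hw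
  have hGy : ∀ w, pd (0, 1) G w = 0 := fun w => pd_snd_comp_fst (fun x => R (x, z.2)) w
  have hHx : pd (1, 0) H = fun _ => 0 := funext fun w => pd_fst_comp_snd (fun y => R (z.1, y)) w
  have hne : R z ≠ 0 := h0 z hz
  have hGH : Set.EqOn R (fun w => (R z)⁻¹ * (G w * H w)) B := by
    intro w hw
    have := hdec.cross (hBV (show (w.1, w.2) ∈ B from hw)) (hBV (show (z.1, z.2) ∈ B from hzB))
      (hBV ⟨hw.1, hz2⟩) (hBV ⟨hz1, hw.2⟩)
    change R w * R z = G w * H w at this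
    simp only [← this]
    field_simp
  have hx : pd (1, 0) R z = (R z)⁻¹ * (pd (1, 0) G z * H z) := by
    rw [pd_congr _ hBo hGH hzB, pd_const_mul _ _ ((dG z hzB).fun_mul (dH z hzB)),
      pd_mul _ (dG z hzB) (dH z hzB), hHx, mul_zero, add_zero]
  have hy : ∀ w ∈ B, pd (0, 1) R w = (R z)⁻¹ * (G w * pd (0, 1) H w) := fun w hw => by
    rw [pd_congr _ hBo hGH hw, pd_const_mul _ _ ((dG w hw).fun_mul (dH w hw)),
      pd_mul _ (dG w hw) (dH w hw), hGy, zero_mul, zero_add]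
  have hxy : pd (1, 0) (pd (0, 1) R) z = (R z)⁻¹ * (pd (1, 0) G z * pd (0, 1) H z) := by
    rw [pd_congr _ hBo hy hzB, pd_const_mul _ _ ((dG z hzB).fun_mul (dH' z hzB)),
      pd_mul _ (dG z hzB) (dH' z hzB), pd_comm _ hBo hH hzB, hHx, pd_const, mul_zero, add_zero]
  rw [hx, hy z hzB, hxy]
  have hGHz : G z = R z ∧ H z = R z := ⟨rfl, rfl⟩
  rw [hGHz.1, hGHz.2]
  field_simp

theorem isLocallyDecomposable_iff (hU : IsOpen U) (hR : ContDiffOn 𝕜 ∞ R U)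
    (h0 : ∀ z ∈ U, R z ≠ 0) : IsLocallyDecomposable R U ↔ MixedLogVanishes R U :=
  ⟨fun h => h.mixedLogVanishes hU hR h0, fun h => h.isLocallyDecomposable hU hR h0⟩

/-- On a product of connected sets, local decomposability implies decomposability. -/
theorem isDecomposable_iff_isLocallyDecomposable (hU : IsOpen U) (hR : ContDiffOn 𝕜 ∞ R U)
    (h0 : ∀ z ∈ U, R z ≠ 0) {I J : Set 𝕜} (hI : IsPreconnected I) (hJ : IsPreconnected J)
    (hIJ : U = I ×ˢ J) : IsDecomposable R U ↔ IsLocallyDecomposable R U := by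
  refine ⟨fun h => h.isLocallyDecomposable hU, fun h => ?_⟩
  rcases U.eq_empty_or_nonempty with he | hne
  · exact ⟨0, 0, by simp [he]⟩
  · rw [hIJ] at hne
    have hopen := hU
    -- Openness of `I` and `J` is not assumed; it follows from that of a nonempty product.
    rw [hIJ, isOpen_prod_iff'] at hopen
    rcases hopen with ⟨hIo, hJo⟩ | he | he
    · have := (h.mixedLogVanishes hU hR h0).isDecomposable hU hR h0 hI hJ hIo hJo hIJ.symm.subset
      rwa [← hIJ] at this
    · exact absurd he hne.fst.ne_empty
    · exact absurd he hne.snd.ne_empty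

end Decomposable

/-! ### Coordinates that straighten the web -/

section Potentials

/-- Convexity of the ball gives a primitive in the real and the holomorphic case alike; its
derivative `f` is smooth, hence so is the primitive. -/
theorem exists_smooth_primitive {x : 𝕜} {r : ℝ} {f : 𝕜 → 𝕜}
    (hf : ContDiffOn 𝕜 ∞ f (Metric.ball x r)) :
    ∃ S : 𝕜 → 𝕜, ContDiffOn 𝕜 ∞ S (Metric.ball x r) ∧ S x = 0 ∧
      ∀ t ∈ Metric.ball x r, HasDerivAt S (f t) t := by
  obtain ⟨g, hg⟩ := (convex_ball x r).exists_forall_hasDerivWithinAt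
    (hf.differentiableOn (by simp))
  have hg' : ∀ t ∈ Metric.ball x r, HasDerivAt (fun t => g t - g x) (f t) t := fun t ht =>
    ((hg t ht).hasDerivAt (Metric.isOpen_ball.mem_nhds ht)).sub_const _
  refine ⟨fun t => g t - g x, ?_, sub_self _, hg'⟩
  rw [contDiffOn_infty_iff_deriv_of_isOpen Metric.isOpen_ball]
  exact ⟨fun t ht => (hg' t ht).differentiableAt.differentiableWithinAt,
    hf.congr fun t ht => (hg' t ht).deriv⟩

/-- Near each point there are coordinates `s(x)`, `t(y)` in which the direction field of slope `R`
becomes that of slope `1`. -/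
theorem MixedLogVanishes.exists_potentials {U : Set (𝕜 × 𝕜)} {R : 𝕜 × 𝕜 → 𝕜} (hU : IsOpen U)
    (hR : ContDiffOn 𝕜 ∞ R U) (h0 : ∀ z ∈ U, R z ≠ 0) (h : MixedLogVanishes R U)
    {z : 𝕜 × 𝕜} (hz : z ∈ U) :
    ∃ V : Set (𝕜 × 𝕜), IsOpen V ∧ z ∈ V ∧ V ⊆ U ∧ ∃ s t : 𝕜 × 𝕜 → 𝕜,
      ContDiffOn 𝕜 ∞ s V ∧ ContDiffOn 𝕜 ∞ t V ∧ s z = 0 ∧ t z = 0 ∧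
      ∀ w ∈ V, pd (0, 1) s w = 0 ∧ pd (1, 0) t w = 0 ∧ pd (0, 1) t w ≠ 0 ∧
        pd (1, 0) s w = R w * pd (0, 1) t w := by
  obtain ⟨r, hr, hB⟩ := exists_ball_prod_subset hU hz
  have hz1 : z.1 ∈ Metric.ball z.1 r := Metric.mem_ball_self hr
  have hz2 : z.2 ∈ Metric.ball z.2 r := Metric.mem_ball_self hr
  have hX : ContDiffOn 𝕜 ∞ (fun x => R (x, z.2)) (Metric.ball z.1 r) :=
    hR.comp (contDiff_id.prodMk contDiff_const).contDiffOn fun w hw => hB ⟨hw, hz2⟩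
  have hY : ContDiffOn 𝕜 ∞ (fun y => R z / R (z.1, y)) (Metric.ball z.2 r) :=
    contDiffOn_const.div
      (hR.comp (contDiff_const.prodMk contDiff_id).contDiffOn fun w hw => hB ⟨hz1, hw⟩)
      fun y hy => h0 _ (hB ⟨hz1, hy⟩)
  -- `S' / T' = R(x, z.2) R(z.1, y) / R(z)`, which is `R(x, y)` by the rectangle identity.
  obtain ⟨S, hS, hS0, hSd⟩ := exists_smooth_primitive hX
  obtain ⟨T, hT, hT0, hTd⟩ := exists_smooth_primitive hY
  have hsV : ContDiffOn 𝕜 ∞ (fun w : 𝕜 × 𝕜 => S w.1) (Metric.ball z.1 r ×ˢ Metric.ball z.2 r) :=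
    hS.comp contDiff_fst.contDiffOn fun w hw => hw.1
  have htV : ContDiffOn 𝕜 ∞ (fun w : 𝕜 × 𝕜 => T w.2) (Metric.ball z.1 r ×ˢ Metric.ball z.2 r) :=
    hT.comp contDiff_snd.contDiffOn fun w hw => hw.2
  have hVo : IsOpen (Metric.ball z.1 r ×ˢ Metric.ball z.2 r) :=
    Metric.isOpen_ball.prod Metric.isOpen_ball
  refine ⟨_, hVo, ⟨hz1, hz2⟩, hB, fun w => S w.1, fun w => T w.2, hsV, htV, hS0, hT0, ?_⟩
  rintro ⟨x, y⟩ hw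
  have e1 : pd (1, 0) (fun w : 𝕜 × 𝕜 => S w.1) (x, y) = R (x, z.2) :=
    (hasDerivAt_slice_fst (ContDiffOn.differentiableAt_of_isOpen hVo hsV hw)).unique
      (hSd x hw.1)
  have e2 : pd (0, 1) (fun w : 𝕜 × 𝕜 => T w.2) (x, y) = R z / R (z.1, y) :=
    (hasDerivAt_slice_snd (ContDiffOn.differentiableAt_of_isOpen hVo htV hw)).unique
      (hTd y hw.2)
  have hne := h0 _ (hB (show (z.1, y) ∈ _ from ⟨hz1, hw.2⟩))
  refine ⟨pd_snd_comp_fst _ _, pd_fst_comp_snd _ _, ?_, ?_⟩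
  · rw [e2]
    exact div_ne_zero (h0 z hz) hne
  · rw [e1, e2, ← mul_div_assoc, eq_div_iff hne]
    exact (h.cross hU hR h0 (isPreconnected_ball _ _) (isPreconnected_ball _ _)
      Metric.isOpen_ball Metric.isOpen_ball hB hw.1 hw.2 hz1 hz2).symm

end Potentials

variable {d : ℕ}

/-! ### Vandermonde systems -/

section Moments

variable {l : Fin d → 𝕜} {w : Fin d → 𝕜} {n : ℕ}

theorem sum_mul_eval_eq_zero (h : ∀ e < n, ∑ j, w j * l j ^ e = 0) (p : Polynomial 𝕜)
    (hp : p.natDegree < n) : ∑ j, w j * p.eval (l j) = 0 := by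
  simp only [Polynomial.eval_eq_sum_range, Finset.mul_sum]
  rw [Finset.sum_comm]
  refine Finset.sum_eq_zero fun e he => ?_
  rw [Finset.mem_range] at he
  rw [← mul_zero (p.coeff e), ← h e (by omega), Finset.mul_sum]
  exact Finset.sum_congr rfl fun j _ => by ring

/-- Invertibility of the `n × n` Vandermonde matrix: pairing `w` with the polynomial that vanishes
at all nodes of index below `n` except `l i` isolates `w i`. -/
theorem eq_zero_of_moments (hl : Function.Injective l) (hw : ∀ j : Fin d, n ≤ j → w j = 0)
    (h : ∀ e < n, ∑ j, w j * l j ^ e = 0) (i : Fin d) : w i = 0 := by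
  classical
  by_cases hi : n ≤ i
  · exact hw i hi
  push Not at hi
  set S : Finset (Fin d) := Finset.univ.filter fun j => (j : ℕ) < n with hS
  have hcard : S.card ≤ n := by
    rw [hS, Fin.card_filter_val_lt]
    exact min_le_right _ _
  have hiS : i ∈ S := by simp [hS, hi]
  have hdeg : (∏ j ∈ S.erase i, (Polynomial.X - Polynomial.C (l j))).natDegree < n := by
    rw [Polynomial.natDegree_prod_of_monic _ _ fun j _ => Polynomial.monic_X_sub_C _]
    simp only [Polynomial.natDegree_X_sub_C, Finset.sum_const, smul_eq_mul, mul_one]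
    exact lt_of_lt_of_le (Finset.card_erase_lt_of_mem hiS) hcard
  have key := sum_mul_eval_eq_zero h _ hdeg
  rw [Finset.sum_eq_single i] at key
  · refine (mul_eq_zero.1 key).resolve_right ?_
    rw [Polynomial.eval_prod, ← ne_eq, Finset.prod_ne_zero_iff]
    intro j hj
    simpa [sub_eq_zero] using fun e => (Finset.ne_of_mem_erase hj) (hl e).symm
  · intro j _ hj
    by_cases hjn : n ≤ j
    · rw [hw j hjn, zero_mul]
    · push Not at hjn
      rw [Polynomial.eval_prod, Finset.prod_eq_zero (i := j), mul_zero]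
      · simp [hS, hj, hjn]
      · simp
  · simp

/-- Lagrange interpolation at the first `n` nodes is exact for `X^e` with `e < n`. Evaluation at `l
i` writes `l i ^ e` through the `l j ^ e`, and the coefficients with opposite sign are the required
`c j`. -/
theorem exists_moments_eq_zero (hl : Function.Injective l) (i : Fin d) (hi : n ≤ i) :
    ∃ c : Fin d → 𝕜, c i = 1 ∧ (∀ j : Fin d, n ≤ j → j ≠ i → c j = 0) ∧
      ∀ e < n, ∑ j, c j * l j ^ e = 0 := by
  classical
  set S : Finset (Fin d) := Finset.univ.filter fun j => (j : ℕ) < n with hS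
  have hcard : S.card = n := by
    rw [hS, Fin.card_filter_val_lt]
    exact min_eq_right (by omega)
  have hiS : i ∉ S := by simp [hS, hi]
  refine ⟨fun j => if j = i then 1 else
    if j ∈ S then -(Lagrange.basis S l j).eval (l i) else 0, by simp, ?_, ?_⟩
  · intro j hj hji
    simp [hji, hS, hj]
  · intro e he
    have hinterp := Lagrange.eq_interpolate (s := S) (v := l) (f := (Polynomial.X : Polynomial 𝕜) ^ e)
      hl.injOn (by rw [Polynomial.degree_X_pow, hcard]; exact_mod_cast he)
    have hev := congrArg (Polynomial.eval (l i)) hinterp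
    simp only [Lagrange.interpolate_apply, Polynomial.eval_finsetSum, Polynomial.eval_mul,
      Polynomial.eval_C, Polynomial.eval_pow, Polynomial.eval_X] at hev
    rw [← Finset.add_sum_erase _ _ (Finset.mem_univ i)]
    simp only [if_true, one_mul]
    have : ∑ j ∈ Finset.univ.erase i, (if j = i then 1 else
        if j ∈ S then -(Lagrange.basis S l j).eval (l i) else 0) * l j ^ e =
        ∑ j ∈ S, -(l j ^ e * (Lagrange.basis S l j).eval (l i)) := by
      symm
      refine Finset.sum_subset_zero_on_sdiff (fun j hj => ?_) (fun j hj => ?_) fun j hj => ?_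
      · exact Finset.mem_erase.2 ⟨fun hji => hiS (hji ▸ hj), Finset.mem_univ _⟩
      · rw [Finset.mem_sdiff, Finset.mem_erase] at hj
        simp [hj.1.1, hj.2]
      · have : j ≠ i := fun hji => hiS (hji ▸ hj)
        simp [this, hj, mul_comm]
    rw [this, Finset.sum_neg_distrib, ← hev, add_neg_cancel]

end Moments

/-! ### Moments with the differentials of first integrals as nodes -/

section Slopes

variable {U : Set (𝕜 × 𝕜)} {R : 𝕜 × 𝕜 → 𝕜} {l : Fin d → 𝕜} {u : Fin d → 𝕜 × 𝕜 → 𝕜}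

theorem HasSlopes.mono {m : Fin d → 𝕜 × 𝕜 → 𝕜} (hu : HasSlopes m U u) {V : Set (𝕜 × 𝕜)}
    (hV : V ⊆ U) : HasSlopes m V u :=
  ⟨⟨fun i => (hu.1.smooth i).mono hV, fun z hz => hu.1.transverse z (hV hz)⟩,
    fun z hz => hu.2 z (hV hz)⟩

theorem HasSlopes.pd_fst (hu : HasSlopes (fun i z => R z * l i) U u) {z : 𝕜 × 𝕜} (hz : z ∈ U)
    (i : Fin d) : pd (1, 0) (u i) z = -l i * R z * pd (0, 1) (u i) z := by
  have : pd (1, 0) (u i) z + R z * l i * pd (0, 1) (u i) z = 0 := hu.2 z hz i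
  linear_combination this

/-- Slopes are finite: if `∂_y u_i` vanished, so would `∂_x u_i`, against transversality to any
other foliation. -/
theorem HasSlopes.pd_snd_ne_zero (hd : 3 ≤ d) {m : Fin d → 𝕜 × 𝕜 → 𝕜} (hu : HasSlopes m U u)
    {z : 𝕜 × 𝕜} (hz : z ∈ U) (i : Fin d) : pd (0, 1) (u i) z ≠ 0 := by
  intro h
  have : Nontrivial (Fin d) := Fin.nontrivial_iff_two_le.2 (by omega)
  obtain ⟨j, hj⟩ := exists_ne i
  have h1 : pdy (u i) z = 0 := h
  have h2 := hu.2 z hz i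
  rw [h1, mul_zero, add_zero] at h2
  exact hu.1.transverse z hz i j hj.symm (by rw [h1, h2]; ring)

/-- The homogeneous moments of `w` with nodes the differentials of the `u i`. -/
theorem HasSlopes.sum_pow_mul_pow (hu : HasSlopes (fun i z => R z * l i) U u) {z : 𝕜 × 𝕜}
    (hz : z ∈ U) (w : Fin d → 𝕜) (A B : ℕ) :
    ∑ j, pd (1, 0) (u j) z ^ A * pd (0, 1) (u j) z ^ B * w j =
      (-R z) ^ A * ∑ j, pd (0, 1) (u j) z ^ (A + B) * w j * l j ^ A := by
  rw [Finset.mul_sum]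
  refine Finset.sum_congr rfl fun j _ => ?_
  rw [hu.pd_fst hz, show -l j * R z * pd (0, 1) (u j) z = -R z * l j * pd (0, 1) (u j) z by ring,
    mul_pow, mul_pow, pow_add]
  ring

/-- The first `n` columns of `P_n` form an invertible matrix: up to the nonzero factors `(∂_y
u_j)^(n-1)` and powers of `-R` it is the Vandermonde matrix of the `l_j`. -/
theorem HasSlopes.eq_zero_of_sum_pow (hd : 3 ≤ d) (hl : Function.Injective l)
    (hu : HasSlopes (fun i z => R z * l i) U u) {z : 𝕜 × 𝕜} (hz : z ∈ U) (hR : R z ≠ 0)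
    {w : Fin d → 𝕜} {n : ℕ} (hw : ∀ j : Fin d, n ≤ j → w j = 0)
    (h : ∀ a < n, ∑ j, pd (1, 0) (u j) z ^ (n - 1 - a) * pd (0, 1) (u j) z ^ a * w j = 0)
    (i : Fin d) : w i = 0 := by
  have key := eq_zero_of_moments (w := fun j => pd (0, 1) (u j) z ^ (n - 1) * w j) hl
    (fun j hj => by rw [hw j hj, mul_zero]) (n := n) (fun e he => by
      have := h (n - 1 - e) (by omega)
      rw [show n - 1 - (n - 1 - e) = e by omega, hu.sum_pow_mul_pow hz,
        show e + (n - 1 - e) = n - 1 by omega] at this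
      exact (mul_eq_zero.1 this).resolve_left (pow_ne_zero _ (neg_ne_zero.2 hR))) i
  exact (mul_eq_zero.1 key).resolve_left (pow_ne_zero _ (hu.pd_snd_ne_zero hd hz i))

end Slopes

/-! ### Linear algebra of the prolonged system -/

section Prolongation

/-- The derivative `∂_x^a ∂_y^b` of the relation `∑ h_i(u_i) = 0`, up to the order `d - 2` in the
`h_i`, as a linear form in the `ω_i^s`. -/
noncomputable def prolong (u : Fin d → 𝕜 × 𝕜 → 𝕜) (z : 𝕜 × 𝕜) (a b : ℕ) (w : Idx d → 𝕜) : 𝕜 :=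
  ∑ s : Fin (d - 2), ∑ j, chainCoeff (u j) a b ((s : ℕ) + 1) z * w (s, j)

/-- The blocks set to `0` in `matMM` would hold coefficients whose index exceeds the order of
differentiation, and these vanish. -/
theorem matMM_mulVec (u : Fin d → 𝕜 × 𝕜 → 𝕜) (z : 𝕜 × 𝕜) (w : Idx d → 𝕜) (p : PivotIdx d) :
    (matMM u z *ᵥ w) p = prolong u z ((p.1.1 : ℕ) + 1 - p.1.2) p.1.2 w := by
  rw [prolong, ← Fintype.sum_prod_type', Matrix.mulVec, dotProduct]
  refine Finset.sum_congr rfl fun q _ => ?_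
  have hp := p.2
  simp only [matMM, Matrix.of_apply, blockG]
  split_ifs with h
  · rw [show (p.1.1 : ℕ) + 2 - ((p.1.1 : ℕ) + 1 - (q.1 : ℕ)) = (q.1 : ℕ) + 1 by omega]
    rfl
  · rw [chainCoeff_of_lt _ _ _ _ (by omega)]

/-- The part of order `n` of the derivatives of order `n`, when the lower coordinates vanish. -/
theorem prolong_eq_of_forall_lt (u : Fin d → 𝕜 × 𝕜 → 𝕜) (z : 𝕜 × 𝕜) {a b : ℕ} {w : Idx d → 𝕜}
    (r : Fin (d - 2)) (hab : a + b = r + 1) (hw : ∀ s < r, ∀ j, w (s, j) = 0) :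
    prolong u z a b w = ∑ j, pd (1, 0) (u j) z ^ a * pd (0, 1) (u j) z ^ b * w (r, j) := by
  rw [prolong, Finset.sum_eq_single r]
  · refine Finset.sum_congr rfl fun j _ => ?_
    rw [← hab, chainCoeff_top]
    rfl
  · intro s _ hs
    refine Finset.sum_eq_zero fun j _ => ?_
    rcases lt_or_gt_of_ne hs with h | h
    · rw [hw s h, mul_zero]
    · rw [chainCoeff_of_lt _ _ _ _ (by have : (r : ℕ) < s := h; omega), zero_mul]
  · simp

variable {U : Set (𝕜 × 𝕜)} {R : 𝕜 × 𝕜 → 𝕜} {l : Fin d → 𝕜} {u : Fin d → 𝕜 × 𝕜 → 𝕜}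

/-- An element of the kernel of `MM` whose free coordinates of the levels up to `r` vanish. -/
theorem HasSlopes.eq_zero_of_mem_ker (hd : 3 ≤ d) (hl : Function.Injective l)
    (hu : HasSlopes (fun i z => R z * l i) U u) {z : 𝕜 × 𝕜} (hz : z ∈ U) (hR : R z ≠ 0)
    {w : Idx d → 𝕜} (hw : matMM u z *ᵥ w = 0) {n : ℕ}
    (hfree : ∀ q : FreeIdx d, (q.1.1 : ℕ) < n → w q.1 = 0) :
    ∀ s : Fin (d - 2), (s : ℕ) < n → ∀ j, w (s, j) = 0 := by
  intro s
  induction s using WellFoundedLT.induction with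
  | _ s ih =>
    intro hs
    -- Once the lower levels vanish, the `s + 2` equations of order `s + 1` involve only the `s + 2`
    -- pivot coordinates of level `s`.
    refine hu.eq_zero_of_sum_pow hd hl hz hR (w := fun j => w (s, j)) (n := s + 2) ?_ ?_
    · intro j hj
      exact hfree ⟨(s, j), by simpa using hj⟩ hs
    · intro a ha
      have h1 := congrFun hw ⟨(s, ⟨a, by omega⟩), ha⟩
      rw [matMM_mulVec, prolong_eq_of_forall_lt u z s (by simp; omega)
        fun t ht => ih t ht (lt_trans ht hs)] at h1
      simpa using h1

theorem completedMM_mulVec (u : Fin d → 𝕜 × 𝕜 → 𝕜) (z : 𝕜 × 𝕜) (w : Idx d → 𝕜) (p : Idx d) :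
    (completedMM u z *ᵥ w) p =
      if h : (p.2 : ℕ) < (p.1 : ℕ) + 2 then (matMM u z *ᵥ w) ⟨p, h⟩ else w p := by
  split_ifs with h
  · simp [Matrix.mulVec, dotProduct, completedMM, h]
  · simp [Matrix.mulVec, dotProduct, completedMM, h]

/-- A vector killed by the completed matrix lies in the kernel of `MM` and has no free coordinates,
so it vanishes level by level. -/
theorem HasSlopes.det_completedMM_ne_zero (hd : 3 ≤ d) (hl : Function.Injective l)
    (hu : HasSlopes (fun i z => R z * l i) U u) {z : 𝕜 × 𝕜} (hz : z ∈ U) (hR : R z ≠ 0) :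
    (completedMM u z).det ≠ 0 := by
  intro h
  obtain ⟨w, hw0, hw⟩ := Matrix.exists_mulVec_eq_zero_iff.2 h
  refine hw0 (funext fun q => ?_)
  refine hu.eq_zero_of_mem_ker hd hl hz hR (n := d) ?_ ?_ q.1 (by omega) q.2
  · funext p
    have := congrFun hw p.1
    rwa [completedMM_mulVec, dif_pos p.2] at this
  · intro q _
    have := congrFun hw q.1
    rwa [completedMM_mulVec, dif_neg q.2] at this

theorem HasSlopes.det_blockP_ne_zero (hd : 3 ≤ d) (hl : Function.Injective l)
    (hu : HasSlopes (fun i z => R z * l i) U u) {z : 𝕜 × 𝕜} (hz : z ∈ U) (hR : R z ≠ 0) :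
    (blockP u d z).det ≠ 0 := by
  intro h
  obtain ⟨w, hw0, hw⟩ := Matrix.exists_mulVec_eq_zero_iff.2 h
  refine hw0 (funext fun q => hu.eq_zero_of_sum_pow hd hl hz hR (n := d) ?_ ?_ q)
  · intro j hj
    omega
  · intro a ha
    have := congrFun hw ⟨a, ha⟩
    simpa [Matrix.mulVec, dotProduct, blockP_apply, pdx_eq_pd, pdy_eq_pd] using this

theorem HasSlopes.matMM_mulVec_kerBasis (hd : 3 ≤ d) (hl : Function.Injective l)
    (hu : HasSlopes (fun i z => R z * l i) U u) {z : 𝕜 × 𝕜} (hz : z ∈ U) (hR : R z ≠ 0)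
    (p : FreeIdx d) : matMM u z *ᵥ kerBasis u z p = 0 ∧
      ∀ q : FreeIdx d, kerBasis u z p q.1 = if q = p then 1 else 0 :=
  kerBasis_spec u z (isUnit_iff_ne_zero.2 (hu.det_completedMM_ne_zero hd hl hz hR)) p

/-- The free coordinates are coordinates in the basis `kerBasis`. -/
theorem HasSlopes.eq_sum_kerBasis (hd : 3 ≤ d) (hl : Function.Injective l)
    (hu : HasSlopes (fun i z => R z * l i) U u) {z : 𝕜 × 𝕜} (hz : z ∈ U) (hR : R z ≠ 0)
    {w : Idx d → 𝕜} (hw : matMM u z *ᵥ w = 0) :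
    w = ∑ p : FreeIdx d, w p.1 • kerBasis u z p := by
  have hdet := isUnit_iff_ne_zero.2 (hu.det_completedMM_ne_zero hd hl hz hR)
  have h1 : completedMM u z *ᵥ w = ∑ p : FreeIdx d, w p.1 • Pi.single p.1 1 := by
    funext q
    rw [completedMM_mulVec, Finset.sum_apply]
    split_ifs with h
    · rw [hw]
      refine (Finset.sum_eq_zero fun p _ => ?_).symm
      have : q ≠ p.1 := fun e => p.2 (e ▸ h)
      simp [this]
    · rw [Finset.sum_eq_single ⟨q, h⟩]
      · simp
      · intro p _ hp
        have : q ≠ p.1 := fun e => hp (Subtype.ext e.symm)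
        simp [this]
      · simp
  calc w = (completedMM u z)⁻¹ *ᵥ (completedMM u z *ᵥ w) := by
        rw [Matrix.mulVec_mulVec, Matrix.nonsing_inv_mul _ hdet, Matrix.one_mulVec]
    _ = _ := by
        rw [h1, Matrix.mulVec_sum]
        simp only [Matrix.mulVec_smul, kerBasis]

theorem matDelta_mulVec_of_lt (u : Fin d → 𝕜 × 𝕜 → 𝕜) (z : 𝕜 × 𝕜) (w : Idx d → 𝕜) (p : Idx d)
    (h : (p.1 : ℕ) + 1 < d - 2) : (matDelta u z *ᵥ w) p = w (⟨p.1 + 1, h⟩, p.2) := by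
  rw [Matrix.mulVec, dotProduct, Finset.sum_eq_single (⟨p.1 + 1, h⟩, p.2)]
  · simp [matDelta, h]
  · intro q _ hq
    have : ¬ ((p.1 : ℕ) + 1 = q.1 ∧ p.2 = q.2) := fun e =>
      hq (Prod.ext (Fin.ext e.1.symm) e.2.symm)
    simp [matDelta, h, this]
  · simp

/-- At the last level `Δ` is given by the derivatives of order `d - 1`. -/
theorem HasSlopes.blockP_mulVec_matDelta (hd : 3 ≤ d) (hl : Function.Injective l)
    (hu : HasSlopes (fun i z => R z * l i) U u) {z : 𝕜 × 𝕜} (hz : z ∈ U) (hR : R z ≠ 0)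
    (w : Idx d → 𝕜) (r : Fin (d - 2)) (hr : ¬ (r : ℕ) + 1 < d - 2) {a : ℕ} (ha : a < d) :
    ∑ j, pd (1, 0) (u j) z ^ (d - 1 - a) * pd (0, 1) (u j) z ^ a * (matDelta u z *ᵥ w) (r, j) +
      prolong u z (d - 1 - a) a w = 0 := by
  have hdet := isUnit_iff_ne_zero.2 (hu.det_blockP_ne_zero hd hl hz hR)
  have h1 : (fun j => (matDelta u z *ᵥ w) (r, j)) =
      -((blockP u d z)⁻¹ *ᵥ fun a : Fin d => prolong u z (d - 1 - a) a w) := by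
    -- Grouped by levels, the lower part of the equations of order `d - 1` is the sum of the blocks
    -- `G_d^j`, to which `coeffA` applies `-P_d⁻¹`.
    have h2 : (fun a : Fin d => prolong u z (d - 1 - a) a w) =
        ∑ s : Fin (d - 2), blockG u d (d - 1 - s) z *ᵥ fun j => w (s, j) := by
      funext a
      rw [prolong, Finset.sum_apply]
      refine Finset.sum_congr rfl fun s _ => Finset.sum_congr rfl fun j _ => ?_
      simp only [blockG, Matrix.of_apply, show d - (d - 1 - (s : ℕ)) = s + 1 by omega]
    rw [h2, Matrix.mulVec_sum]
    funext j
    rw [Pi.neg_apply, Finset.sum_apply, Matrix.mulVec, dotProduct, Fintype.sum_prod_type,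
      ← Finset.sum_neg_distrib]
    refine Finset.sum_congr rfl fun s _ => ?_
    rw [Matrix.mulVec_mulVec, Matrix.mulVec, dotProduct, ← Finset.sum_neg_distrib]
    refine Finset.sum_congr rfl fun k _ => ?_
    simp [matDelta, hr, coeffA]
  have h3 := congrArg (fun v => (blockP u d z *ᵥ v) ⟨a, ha⟩) h1
  simp only [Matrix.mulVec_neg, Matrix.mulVec_mulVec, Matrix.mul_nonsing_inv _ hdet,
    Matrix.one_mulVec, Pi.neg_apply] at h3
  rw [← sub_eq_zero, sub_neg_eq_add] at h3
  rw [Matrix.mulVec, dotProduct] at h3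
  simp only [blockP_apply] at h3
  exact h3

end Prolongation

/-! ### Smoothness of the connection matrices -/

section Smoothness

variable {U : Set (𝕜 × 𝕜)} {ι : Type*} [Fintype ι] [DecidableEq ι]

theorem contDiffOn_det {M : 𝕜 × 𝕜 → Matrix ι ι 𝕜}
    (hM : ∀ i j, ContDiffOn 𝕜 ∞ (fun z => M z i j) U) :
    ContDiffOn 𝕜 ∞ (fun z => (M z).det) U := by
  simp only [Matrix.det_apply']
  exact ContDiffOn.sum fun σ _ => contDiffOn_const.mul (contDiffOn_prod fun i _ => hM _ _)

theorem contDiffOn_matrix_inv {M : 𝕜 × 𝕜 → Matrix ι ι 𝕜}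
    (hM : ∀ i j, ContDiffOn 𝕜 ∞ (fun z => M z i j) U) (hdet : ∀ z ∈ U, (M z).det ≠ 0) (i j : ι) :
    ContDiffOn 𝕜 ∞ (fun z => (M z)⁻¹ i j) U := by
  -- Cramer's rule reduces smoothness of the inverse to that of determinants.
  have : ∀ z, (M z)⁻¹ i j = ((M z).det)⁻¹ * ((M z).updateRow j (Pi.single i 1)).det := fun z => by
    rw [Matrix.inv_def, Matrix.smul_apply, Matrix.adjugate_apply, Ring.inverse_eq_inv', smul_eq_mul]
  simp only [this]
  refine ((contDiffOn_det hM).inv hdet).mul (contDiffOn_det fun a b => ?_)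
  by_cases h : a = j
  · subst h
    simp only [Matrix.updateRow_self]
    exact contDiffOn_const
  · simp only [Matrix.updateRow_ne h]
    exact hM a b

end Smoothness

theorem contDiffOn_matrix_mul {U : Set (𝕜 × 𝕜)} {ι m n : Type*} [Fintype ι] {A : 𝕜 × 𝕜 → Matrix m ι 𝕜} {B : 𝕜 × 𝕜 → Matrix ι n 𝕜}
    (hA : ∀ i j, ContDiffOn 𝕜 ∞ (fun z => A z i j) U)
    (hB : ∀ i j, ContDiffOn 𝕜 ∞ (fun z => B z i j) U) (i : m) (j : n) :
    ContDiffOn 𝕜 ∞ (fun z => (A z * B z) i j) U := by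
  simp only [Matrix.mul_apply]
  exact ContDiffOn.sum fun k _ => (hA i k).mul (hB k j)

section Connection

variable {U : Set (𝕜 × 𝕜)} {R : 𝕜 × 𝕜 → 𝕜} {l : Fin d → 𝕜} {u : Fin d → 𝕜 × 𝕜 → 𝕜}

theorem contDiffOn_blockG (hU : IsOpen U) (hu : ∀ i, ContDiffOn 𝕜 ∞ (u i) U) (r j : ℕ)
    (a : Fin r) (i : Fin d) : ContDiffOn 𝕜 ∞ (fun z => blockG u r j z a i) U :=
  contDiffOn_chainCoeff hU (hu i) _ _ _

theorem contDiffOn_completedMM (hU : IsOpen U) (hu : ∀ i, ContDiffOn 𝕜 ∞ (u i) U)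
    (p q : Idx d) : ContDiffOn 𝕜 ∞ (fun z => completedMM u z p q) U := by
  simp only [completedMM, Matrix.of_apply, matMM]
  split_ifs
  · exact contDiffOn_blockG hU hu _ _ _ _
  all_goals exact contDiffOn_const

theorem HasSlopes.contDiffOn_kerBasis (hd : 3 ≤ d) (hl : Function.Injective l) (hU : IsOpen U)
    (hu : HasSlopes (fun i z => R z * l i) U u) (hR : ∀ z ∈ U, R z ≠ 0) (p : FreeIdx d)
    (q : Idx d) : ContDiffOn 𝕜 ∞ (fun z => kerBasis u z p q) U := by
  simp only [kerBasis, Matrix.mulVec_single_one]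
  exact contDiffOn_matrix_inv (contDiffOn_completedMM hU hu.1.smooth)
    (fun z hz => hu.det_completedMM_ne_zero hd hl hz (hR z hz)) _ _

theorem HasSlopes.contDiffOn_matDelta (hd : 3 ≤ d) (hl : Function.Injective l) (hU : IsOpen U)
    (hu : HasSlopes (fun i z => R z * l i) U u) (hR : ∀ z ∈ U, R z ≠ 0) (p q : Idx d) :
    ContDiffOn 𝕜 ∞ (fun z => matDelta u z p q) U := by
  simp only [matDelta, Matrix.of_apply, coeffA, Matrix.neg_apply]
  split_ifs
  · exact contDiffOn_const
  · exact contDiffOn_const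
  · exact (contDiffOn_matrix_mul (contDiffOn_matrix_inv
      (fun a i => contDiffOn_blockG hU hu.1.smooth _ _ a i)
      fun z hz => hu.det_blockP_ne_zero hd hl hz (hR z hz))
      (fun a i => contDiffOn_blockG hU hu.1.smooth _ _ a i) _ _).neg

theorem omegaX_apply (u : Fin d → 𝕜 × 𝕜 → 𝕜) (z : 𝕜 × 𝕜) (p q : FreeIdx d) :
    omegaX u z p q = -(pd (1, 0) (u q.1.2) z * (matDelta u z *ᵥ kerBasis u z p) q.1) := by
  rw [omegaX, Matrix.of_apply, deltaX, ← Matrix.mulVec_mulVec, Matrix.mulVec_diagonal]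
  rfl

theorem omegaY_apply (u : Fin d → 𝕜 × 𝕜 → 𝕜) (z : 𝕜 × 𝕜) (p q : FreeIdx d) :
    omegaY u z p q = -(pd (0, 1) (u q.1.2) z * (matDelta u z *ᵥ kerBasis u z p) q.1) := by
  rw [omegaY, Matrix.of_apply, deltaY, ← Matrix.mulVec_mulVec, Matrix.mulVec_diagonal]
  rfl

theorem HasSlopes.contDiffOn_matDelta_mulVec (hd : 3 ≤ d) (hl : Function.Injective l)
    (hU : IsOpen U) (hu : HasSlopes (fun i z => R z * l i) U u) (hR : ∀ z ∈ U, R z ≠ 0)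
    (p : FreeIdx d) (q : Idx d) :
    ContDiffOn 𝕜 ∞ (fun z => (matDelta u z *ᵥ kerBasis u z p) q) U := by
  simp only [Matrix.mulVec, dotProduct]
  exact ContDiffOn.sum fun k _ =>
    (hu.contDiffOn_matDelta hd hl hU hR q k).mul (hu.contDiffOn_kerBasis hd hl hU hR p k)

theorem HasSlopes.contDiffOn_omegaX (hd : 3 ≤ d) (hl : Function.Injective l) (hU : IsOpen U)
    (hu : HasSlopes (fun i z => R z * l i) U u) (hR : ∀ z ∈ U, R z ≠ 0) (p q : FreeIdx d) :
    ContDiffOn 𝕜 ∞ (fun z => omegaX u z p q) U := by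
  simp only [omegaX_apply]
  exact ((contDiffOn_pd _ hU (hu.1.smooth _)).mul
    (hu.contDiffOn_matDelta_mulVec hd hl hU hR p q.1)).neg

theorem HasSlopes.contDiffOn_omegaY (hd : 3 ≤ d) (hl : Function.Injective l) (hU : IsOpen U)
    (hu : HasSlopes (fun i z => R z * l i) U u) (hR : ∀ z ∈ U, R z ≠ 0) (p q : FreeIdx d) :
    ContDiffOn 𝕜 ∞ (fun z => omegaY u z p q) U := by
  simp only [omegaY_apply]
  exact ((contDiffOn_pd _ hU (hu.1.smooth _)).mul
    (hu.contDiffOn_matDelta_mulVec hd hl hU hR p q.1)).neg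

end Connection

/-! ### Abelian relations as horizontal sections -/

section Horizontal

/-- The sequence of the derivatives `W s i = h_i^(s)(u_i)` of an abelian relation
`∑ i, h_i(u_i) = 0` of the web `u` on `U`. -/
structure IsAbelianRelation (U : Set (𝕜 × 𝕜)) (u : Fin d → 𝕜 × 𝕜 → 𝕜)
    (W : ℕ → Fin d → 𝕜 × 𝕜 → 𝕜) : Prop where
  smooth : ∀ s i, ContDiffOn 𝕜 ∞ (W s i) U
  pd_fst : ∀ s i, ∀ z ∈ U, pd (1, 0) (W s i) z = pd (1, 0) (u i) z * W (s + 1) i z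
  pd_snd : ∀ s i, ∀ z ∈ U, pd (0, 1) (W s i) z = pd (0, 1) (u i) z * W (s + 1) i z
  sum_eq_zero : ∀ z ∈ U, ∑ i, W 0 i z = 0

variable {U : Set (𝕜 × 𝕜)} {R : 𝕜 × 𝕜 → 𝕜} {l : Fin d → 𝕜} {u : Fin d → 𝕜 × 𝕜 → 𝕜}
  {W : ℕ → Fin d → 𝕜 × 𝕜 → 𝕜}

/-- The section of the trivial bundle given by the derivatives of orders `1, …, d - 2`. -/
def jet (W : ℕ → Fin d → 𝕜 × 𝕜 → 𝕜) (z : 𝕜 × 𝕜) : Idx d → 𝕜 :=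
  fun q => W ((q.1 : ℕ) + 1) q.2 z

/-- The undifferentiated `h_i` drop out because `chainCoeff` has value `0` at `s = 0` in positive
order; this is why the bundle starts with `ω^1`. -/
theorem IsAbelianRelation.sum_chainCoeff (hW : IsAbelianRelation U u W) (hU : IsOpen U)
    (hu : ∀ i, ContDiffOn 𝕜 ∞ (u i) U) {z : 𝕜 × 𝕜} (hz : z ∈ U) {a b n : ℕ} (hn : a + b = n + 1) :
    ∑ s ∈ Finset.range (n + 1), ∑ i, chainCoeff (u i) a b (s + 1) z * W (s + 1) i z = 0 := by
  rw [← sum_chainCoeff_eq_zero hU hu hW.smooth hW.pd_fst hW.pd_snd hW.sum_eq_zero a b z hz,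
    Finset.sum_comm, hn]
  refine Finset.sum_congr rfl fun i _ => ?_
  rw [Finset.sum_range_succ' _ (n + 1), chainCoeff_zero_right _ _ _ (by omega), zero_mul, add_zero]

theorem IsAbelianRelation.prolong_jet (hW : IsAbelianRelation U u W) (hU : IsOpen U)
    (hu : ∀ i, ContDiffOn 𝕜 ∞ (u i) U) {z : 𝕜 × 𝕜} (hz : z ∈ U) {a b : ℕ} (h1 : 0 < a + b)
    (h2 : a + b ≤ d - 2) : prolong u z a b (jet W z) = 0 := by
  obtain ⟨n, hn⟩ : ∃ n, a + b = n + 1 := ⟨a + b - 1, by omega⟩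
  rw [← hW.sum_chainCoeff hU hu hz hn, prolong]
  simp only [jet]
  rw [Fin.sum_univ_eq_sum_range
    (fun s => ∑ j, chainCoeff (u j) a b (s + 1) z * W (s + 1) j z) (d - 2)]
  symm
  refine Finset.sum_subset (Finset.range_subset_range.2 (by omega)) fun s _ hs => ?_
  rw [Finset.mem_range] at hs
  exact Finset.sum_eq_zero fun i _ => by rw [chainCoeff_of_lt _ _ _ _ (by omega), zero_mul]

theorem IsAbelianRelation.matMM_mulVec_jet (hW : IsAbelianRelation U u W) (hU : IsOpen U)
    (hu : ∀ i, ContDiffOn 𝕜 ∞ (u i) U) {z : 𝕜 × 𝕜} (hz : z ∈ U) : matMM u z *ᵥ jet W z = 0 := by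
  funext p
  have := p.2
  rw [matMM_mulVec, hW.prolong_jet hU hu hz (by omega) (by omega), Pi.zero_apply]

/-- On jets of abelian relations `Δ` raises the order of differentiation by one. At the last level
both sides solve the equations of order `d - 1`, whose leading matrix `P_d` is invertible. -/
theorem IsAbelianRelation.matDelta_mulVec_jet (hd : 3 ≤ d) (hl : Function.Injective l)
    (hW : IsAbelianRelation U u W) (hU : IsOpen U)
    (hu : HasSlopes (fun i z => R z * l i) U u) {z : 𝕜 × 𝕜} (hz : z ∈ U) (hR : R z ≠ 0)
    (p : Idx d) : (matDelta u z *ᵥ jet W z) p = W ((p.1 : ℕ) + 2) p.2 z := by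
  by_cases hp : (p.1 : ℕ) + 1 < d - 2
  · rw [matDelta_mulVec_of_lt _ _ _ _ hp]
    rfl
  · have hp1 : (p.1 : ℕ) + 1 = d - 2 := by omega
    have := hu.eq_zero_of_sum_pow hd hl hz hR (n := d)
      (w := fun j => (matDelta u z *ᵥ jet W z) (p.1, j) - W ((p.1 : ℕ) + 2) j z)
      (fun j hj => by omega) (fun a ha => ?_) p.2
    · exact sub_eq_zero.1 this
    · have h1 := hu.blockP_mulVec_matDelta hd hl hz hR (jet W z) p.1 hp ha
      have h2 := hW.sum_chainCoeff hU hu.1.smooth hz (a := d - 1 - a) (b := a) (n := d - 2)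
        (by omega)
      rw [Finset.sum_range_succ] at h2
      have h3 : prolong u z (d - 1 - a) a (jet W z) = ∑ s ∈ Finset.range (d - 2), ∑ i,
          chainCoeff (u i) (d - 1 - a) a (s + 1) z * W (s + 1) i z := by
        rw [prolong]
        simp only [jet]
        rw [Fin.sum_univ_eq_sum_range
          (fun s => ∑ j, chainCoeff (u j) (d - 1 - a) a (s + 1) z * W (s + 1) j z) (d - 2)]
      rw [h3, add_comm] at h1
      have h1 := add_left_cancel (h1.trans h2.symm)
      simp only [mul_sub, Finset.sum_sub_distrib]
      rw [h1, sub_eq_zero]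
      refine Finset.sum_congr rfl fun j _ => ?_
      have h4 := congrFun (chainCoeff_top (u j) (d - 1 - a) a) z
      rw [show d - 1 - a + a = d - 2 + 1 by omega] at h4
      rw [h4, show d - 2 + 1 = (p.1 : ℕ) + 2 by omega]
      rfl

/-- Abelian relations give horizontal sections, written in the basis `kerBasis`. -/
theorem IsAbelianRelation.pd_fst_jet (hd : 3 ≤ d) (hl : Function.Injective l)
    (hW : IsAbelianRelation U u W) (hU : IsOpen U)
    (hu : HasSlopes (fun i z => R z * l i) U u) {z : 𝕜 × 𝕜} (hz : z ∈ U) (hR : R z ≠ 0)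
    (q : FreeIdx d) : pd (1, 0) (fun w => jet W w q.1) z =
      -∑ p : FreeIdx d, jet W z p.1 * omegaX u z p q := by
  have h1 : (matDelta u z *ᵥ jet W z) q.1 =
      ∑ p : FreeIdx d, jet W z p.1 * (matDelta u z *ᵥ kerBasis u z p) q.1 := by
    conv_lhs => rw [hu.eq_sum_kerBasis hd hl hz hR (hW.matMM_mulVec_jet hU hu.1.smooth hz)]
    rw [Matrix.mulVec_sum, Finset.sum_apply]
    simp only [Matrix.mulVec_smul, Pi.smul_apply, smul_eq_mul]
  have h2 := hW.pd_fst ((q.1.1 : ℕ) + 1) q.1.2 z hz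
  rw [← hW.matDelta_mulVec_jet hd hl hU hu hz hR, h1, Finset.mul_sum] at h2
  rw [← Finset.sum_neg_distrib]
  refine h2.trans (Finset.sum_congr rfl fun p _ => ?_)
  rw [omegaX_apply]
  ring

theorem IsAbelianRelation.pd_snd_jet (hd : 3 ≤ d) (hl : Function.Injective l)
    (hW : IsAbelianRelation U u W) (hU : IsOpen U)
    (hu : HasSlopes (fun i z => R z * l i) U u) {z : 𝕜 × 𝕜} (hz : z ∈ U) (hR : R z ≠ 0)
    (q : FreeIdx d) : pd (0, 1) (fun w => jet W w q.1) z =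
      -∑ p : FreeIdx d, jet W z p.1 * omegaY u z p q := by
  have h1 : (matDelta u z *ᵥ jet W z) q.1 =
      ∑ p : FreeIdx d, jet W z p.1 * (matDelta u z *ᵥ kerBasis u z p) q.1 := by
    conv_lhs => rw [hu.eq_sum_kerBasis hd hl hz hR (hW.matMM_mulVec_jet hU hu.1.smooth hz)]
    rw [Matrix.mulVec_sum, Finset.sum_apply]
    simp only [Matrix.mulVec_smul, Pi.smul_apply, smul_eq_mul]
  have h2 := hW.pd_snd ((q.1.1 : ℕ) + 1) q.1.2 z hz
  rw [← hW.matDelta_mulVec_jet hd hl hU hu hz hR, h1, Finset.mul_sum] at h2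
  rw [← Finset.sum_neg_distrib]
  refine h2.trans (Finset.sum_congr rfl fun p _ => ?_)
  rw [omegaY_apply]
  ring

/-- The integrability condition of a linear system `∂_e β = - β A`, `∂_f β = - β B`. -/
theorem vecMul_integrability {ι : Type*} [Fintype ι] (hU : IsOpen U) (e f : 𝕜 × 𝕜)
    {β : ι → 𝕜 × 𝕜 → 𝕜} {A B : ι → ι → 𝕜 × 𝕜 → 𝕜} (hβ : ∀ q, ContDiffOn 𝕜 ∞ (β q) U)
    (hA : ∀ p q, ContDiffOn 𝕜 ∞ (A p q) U)
    (he : ∀ q, ∀ z ∈ U, pd e (β q) z = -∑ p, β p z * A p q z)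
    (hf : ∀ q, ∀ z ∈ U, pd f (β q) z = -∑ p, β p z * B p q z) {z : 𝕜 × 𝕜} (hz : z ∈ U) (q : ι) :
    pd f (pd e (β q)) z =
      (∑ p, (∑ r, β r z * B r p z) * A p q z) - ∑ p, β p z * pd f (A p q) z := by
  have dβ : ∀ p, DifferentiableAt 𝕜 (β p) z := fun p =>
    ContDiffOn.differentiableAt_of_isOpen hU (hβ p) hz
  have dA : ∀ p, DifferentiableAt 𝕜 (A p q) z := fun p =>
    ContDiffOn.differentiableAt_of_isOpen hU (hA p q) hz
  rw [pd_congr f hU (he q) hz, pd_neg, pd_sum f _ fun p _ => (dβ p).fun_mul (dA p),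
    Finset.sum_congr rfl fun p _ => pd_mul f (dβ p) (dA p), Finset.sum_add_distrib, neg_add,
    ← sub_eq_add_neg, ← Finset.sum_neg_distrib]
  congr 1
  exact Finset.sum_congr rfl fun p _ => by rw [hf p z hz]; ring

/-- The curvature annihilates horizontal sections. -/
theorem IsAbelianRelation.sum_mul_curvature (hd : 3 ≤ d) (hl : Function.Injective l)
    (hW : IsAbelianRelation U u W) (hU : IsOpen U)
    (hu : HasSlopes (fun i z => R z * l i) U u) (hR : ∀ z ∈ U, R z ≠ 0) {z : 𝕜 × 𝕜} (hz : z ∈ U)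
    (q : FreeIdx d) : ∑ p : FreeIdx d, jet W z p.1 * curvature u z p q = 0 := by
  have hβ : ∀ q : FreeIdx d, ContDiffOn 𝕜 ∞ (fun w => jet W w q.1) U := fun q => hW.smooth _ _
  have hx := fun (q : FreeIdx d) z hz => hW.pd_fst_jet hd hl hU hu (z := z) hz (hR z hz) q
  have hy := fun (q : FreeIdx d) z hz => hW.pd_snd_jet hd hl hU hu (z := z) hz (hR z hz) q
  have h1 := vecMul_integrability hU (1, 0) (0, 1) (β := fun (q : FreeIdx d) w => jet W w q.1)
    (A := fun p q w => omegaX u w p q) (B := fun p q w => omegaY u w p q) hβ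
    (hu.contDiffOn_omegaX hd hl hU hR) hx hy hz q
  have h2 := vecMul_integrability hU (0, 1) (1, 0) (β := fun (q : FreeIdx d) w => jet W w q.1)
    (A := fun p q w => omegaY u w p q) (B := fun p q w => omegaX u w p q) hβ
    (hu.contDiffOn_omegaY hd hl hU hR) hy hx hz q
  -- Equality of the mixed second derivatives of the free coordinates is the relation `β K = 0`.
  rw [pd_comm _ hU (hβ q) hz, h2] at h1
  have assoc : ∀ A B : Matrix (FreeIdx d) (FreeIdx d) 𝕜,
      ∑ p : FreeIdx d, (∑ r : FreeIdx d, jet W z r.1 * A r p) * B p q =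
        ∑ p : FreeIdx d, jet W z p.1 * (A * B) p q := fun A B =>
    congrFun (Matrix.vecMul_vecMul (fun p : FreeIdx d => jet W z p.1) A B) q
  rw [assoc (omegaX u z) (omegaY u z), assoc (omegaY u z) (omegaX u z)] at h1
  simp only [curvature, Matrix.add_apply, Matrix.sub_apply, Matrix.of_apply, mul_add, mul_sub,
    Finset.sum_add_distrib, Finset.sum_sub_distrib, pdx_eq_pd, pdy_eq_pd]
  linear_combination h1

end Horizontal

/-! ### Differentiation with respect to a first integral -/

section Derivation

variable {U : Set (𝕜 × 𝕜)} {g v μ : 𝕜 × 𝕜 → 𝕜}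

/-- The iterated derivatives of `F` with respect to `g`, for `F` a function of `g`. -/
noncomputable def iterDer (g F : 𝕜 × 𝕜 → 𝕜) : ℕ → 𝕜 × 𝕜 → 𝕜
  | 0 => F
  | s + 1 => fun z => pd (0, 1) (iterDer g F s) z / pd (0, 1) g z

theorem contDiffOn_iterDer (hU : IsOpen U) (hg : ContDiffOn 𝕜 ∞ g U)
    (hg0 : ∀ z ∈ U, pd (0, 1) g z ≠ 0) {F : 𝕜 × 𝕜 → 𝕜} (hF : ContDiffOn 𝕜 ∞ F U) (s : ℕ) :
    ContDiffOn 𝕜 ∞ (iterDer g F s) U := by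
  induction s with
  | zero => exact hF
  | succ s ih => exact (contDiffOn_pd _ hU ih).div (contDiffOn_pd _ hU hg) hg0

theorem pd_snd_iterDer {z : 𝕜 × 𝕜} (hg0 : pd (0, 1) g z ≠ 0) (F : 𝕜 × 𝕜 → 𝕜) (s : ℕ) :
    pd (0, 1) (iterDer g F s) z = pd (0, 1) g z * iterDer g F (s + 1) z := by
  rw [iterDer, mul_div_cancel₀ _ hg0]

/-- If `g` and `F` have the same level curves, so have `g` and the derivatives of `F` with respect
to `g`. -/
theorem pd_fst_iterDer (hU : IsOpen U) (hg : ContDiffOn 𝕜 ∞ g U)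
    (hg0 : ∀ z ∈ U, pd (0, 1) g z ≠ 0) (hgμ : ∀ z ∈ U, pd (1, 0) g z = μ z * pd (0, 1) g z)
    {F : 𝕜 × 𝕜 → 𝕜} (hF : ContDiffOn 𝕜 ∞ F U)
    (hFμ : ∀ z ∈ U, pd (1, 0) F z = μ z * pd (0, 1) F z) (s : ℕ) :
    ∀ z ∈ U, pd (1, 0) (iterDer g F s) z = pd (1, 0) g z * iterDer g F (s + 1) z := by
  have reform : ∀ s z, z ∈ U → pd (1, 0) (iterDer g F s) z = μ z * pd (0, 1) (iterDer g F s) z →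
      pd (1, 0) (iterDer g F s) z = pd (1, 0) g z * iterDer g F (s + 1) z := by
    intro s z hz h
    rw [h, hgμ z hz, mul_assoc, pd_snd_iterDer (hg0 z hz)]
  suffices h : ∀ z ∈ U, pd (1, 0) (iterDer g F s) z = μ z * pd (0, 1) (iterDer g F s) z from
    fun z hz => reform s z hz (h z hz)
  induction s with
  | zero => exact hFμ
  | succ s ih =>
    intro z hz
    have dg : ∀ e, DifferentiableAt 𝕜 (pd e g) z := fun e =>
      ContDiffOn.differentiableAt_of_isOpen hU (contDiffOn_pd e hU hg) hz
    have dG : DifferentiableAt 𝕜 (iterDer g F (s + 1)) z :=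
      ContDiffOn.differentiableAt_of_isOpen hU (contDiffOn_iterDer hU hg hg0 hF (s + 1)) hz
    -- With `F'` the next derivative, this compares `∂_x (g_y F')` with `∂_y (g_x F')`. The terms
    -- `g_xy F'` cancel, leaving `g_y F'_x = g_x F'_y`.
    have h1 := pd_comm (1, 0) hU (contDiffOn_iterDer hU hg hg0 hF s) hz (0, 1)
    have e1 : Set.EqOn (pd (0, 1) (iterDer g F s))
      (fun w => pd (0, 1) g w * iterDer g F (s + 1) w) U := fun w hw =>
      pd_snd_iterDer (hg0 w hw) F s
    have e2 : Set.EqOn (pd (1, 0) (iterDer g F s))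
      (fun w => pd (1, 0) g w * iterDer g F (s + 1) w) U := fun w hw => reform s w hw (ih w hw)
    rw [pd_congr _ hU e1 hz, pd_congr _ hU e2 hz, pd_mul _ (dg _) dG, pd_mul _ (dg _) dG,
      pd_comm (1, 0) hU hg hz, add_right_inj, hgμ z hz] at h1
    exact mul_left_cancel₀ (hg0 z hz) (by linear_combination h1)

/-- As `v` has a simple zero at `z₀` in the `y`-direction, each derivation removes exactly one
factor `v`; the new cofactor at `z₀` is a nonzero multiple of the old one. -/
theorem iterDer_pow_eq (hU : IsOpen U) (hg : ContDiffOn 𝕜 ∞ g U)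
    (hg0 : ∀ z ∈ U, pd (0, 1) g z ≠ 0) (hv : ContDiffOn 𝕜 ∞ v U)
    {z₀ : 𝕜 × 𝕜} (hz₀ : z₀ ∈ U) (hv0 : v z₀ = 0) (hv1 : pd (0, 1) v z₀ ≠ 0) (m s : ℕ) (hs : s ≤ m) :
    ∃ G : 𝕜 × 𝕜 → 𝕜, ContDiffOn 𝕜 ∞ G U ∧ G z₀ ≠ 0 ∧
      ∀ z ∈ U, iterDer g (fun w => v w ^ m) s z = v z ^ (m - s) * G z := by
  induction s with
  | zero => exact ⟨fun _ => 1, contDiffOn_const, one_ne_zero, fun z _ => by simp [iterDer]⟩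
  | succ s ih =>
    obtain ⟨G, hG, hG0, h⟩ := ih (by omega)
    obtain ⟨n, hn⟩ : ∃ n, m - s = n + 1 := ⟨m - s - 1, by omega⟩
    refine ⟨fun z => (((n + 1 : ℕ) : 𝕜) * pd (0, 1) v z * G z + v z * pd (0, 1) G z) /
      pd (0, 1) g z, ?_, ?_, ?_⟩
    · exact (((contDiffOn_const.mul (contDiffOn_pd _ hU hv)).mul hG).add
        (hv.mul (contDiffOn_pd _ hU hG))).div (contDiffOn_pd _ hU hg) hg0
    · simp only [hv0, zero_mul, add_zero]
      exact div_ne_zero (mul_ne_zero (mul_ne_zero (Nat.cast_ne_zero.2 n.succ_ne_zero) hv1) hG0)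
        (hg0 _ hz₀)
    · intro z hz
      have dv : DifferentiableAt 𝕜 v z := ContDiffOn.differentiableAt_of_isOpen hU hv hz
      have dG : DifferentiableAt 𝕜 G z := ContDiffOn.differentiableAt_of_isOpen hU hG hz
      have e : pd (0, 1) (iterDer g (fun w => v w ^ m) s) z =
          v z ^ n * (((n + 1 : ℕ) : 𝕜) * pd (0, 1) v z * G z + v z * pd (0, 1) G z) := by
        rw [pd_congr _ hU h hz, hn, pd_mul _ (dv.fun_pow _) dG, pd_pow _ dv, Nat.add_sub_cancel,
          pow_succ]
        ring
      simp only [iterDer]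
      rw [e, show m - (s + 1) = n by omega, mul_div_assoc]

end Derivation

/-! ### Vanishing mixed derivative implies flatness -/

section Flat

variable {U : Set (𝕜 × 𝕜)} {R : 𝕜 × 𝕜 → 𝕜} {l : Fin d → 𝕜} {u : Fin d → 𝕜 × 𝕜 → 𝕜}

theorem HasSlopes.curvature_eq_zero (hd : 3 ≤ d) (hl : Function.Injective l) (hU : IsOpen U)
    (hRs : ContDiffOn 𝕜 ∞ R U) (hR : ∀ z ∈ U, R z ≠ 0) (h : MixedLogVanishes R U)
    (hu : HasSlopes (fun i z => R z * l i) U u) {z : 𝕜 × 𝕜} (hz : z ∈ U) :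
    curvature u z = 0 := by
  obtain ⟨V, hVo, hzV, hVU, s, t, hs, ht, hs0, ht0, hst⟩ := h.exists_potentials hU hRs hR hz
  have huV := hu.mono hVU
  have hRV : ∀ w ∈ V, R w ≠ 0 := fun w hw => hR w (hVU hw)
  -- These linear first integrals all vanish at `z`. The given `u i` may differ from them, so powers
  -- of `v i` are differentiated with respect to `u i`.
  set v : Fin d → 𝕜 × 𝕜 → 𝕜 := fun i w => t w - l i * s w with hvdef
  have ds : ∀ w ∈ V, DifferentiableAt 𝕜 s w := fun w hw =>
    ContDiffOn.differentiableAt_of_isOpen hVo hs hw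
  have dt : ∀ w ∈ V, DifferentiableAt 𝕜 t w := fun w hw =>
    ContDiffOn.differentiableAt_of_isOpen hVo ht hw
  have hv : ∀ i, ContDiffOn 𝕜 ∞ (v i) V := fun i => ht.sub (contDiffOn_const.mul hs)
  have hve : ∀ i e, ∀ w ∈ V, pd e (v i) w = pd e t w - l i * pd e s w := fun i e w hw => by
    rw [hvdef, pd_sub e (dt w hw) ((ds w hw).const_mul (l i)), pd_const_mul e _ (ds w hw)]
  have hvx : ∀ i, ∀ w ∈ V, pd (1, 0) (v i) w = -l i * R w * pd (0, 1) (v i) w := by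
    intro i w hw
    obtain ⟨h1, h2, _, h4⟩ := hst w hw
    rw [hve i _ w hw, hve i _ w hw, h1, h2, h4]
    ring
  have hvy : ∀ i, pd (0, 1) (v i) z ≠ 0 := by
    intro i
    obtain ⟨h1, _, h3, _⟩ := hst z hzV
    rwa [hve i _ z hzV, h1, mul_zero, sub_zero]
  have hv0 : ∀ i, v i z = 0 := fun i => by simp [hvdef, hs0, ht0]
  have hu0 : ∀ i, ∀ w ∈ V, pd (0, 1) (u i) w ≠ 0 := fun i w hw => huV.pd_snd_ne_zero hd hw i
  set T : ℕ → ℕ → Fin d → 𝕜 × 𝕜 → 𝕜 := fun m k i => iterDer (u i) (fun w => v i w ^ m) k with hT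
  have hTs : ∀ m k i, ContDiffOn 𝕜 ∞ (T m k i) V := fun m k i =>
    contDiffOn_iterDer hVo (huV.1.smooth i) (hu0 i) ((hv i).pow m) k
  have dT : ∀ m k i, ∀ w ∈ V, DifferentiableAt 𝕜 (T m k i) w := fun m k i w hw =>
    ContDiffOn.differentiableAt_of_isOpen hVo (hTs m k i) hw
  have hTx : ∀ m k i, ∀ w ∈ V, pd (1, 0) (T m k i) w = pd (1, 0) (u i) w * T m (k + 1) i w := by
    intro m k i
    refine pd_fst_iterDer hVo (huV.1.smooth i) (hu0 i) (μ := fun w => -l i * R w)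
      (fun w hw => huV.pd_fst hw i) ((hv i).pow m) (fun w hw => ?_) k
    have dv := ContDiffOn.differentiableAt_of_isOpen hVo (hv i) hw
    rw [pd_pow _ dv, pd_pow _ dv, hvx i w hw]
    ring
  have hTy : ∀ m k i, ∀ w ∈ V, pd (0, 1) (T m k i) w = pd (0, 1) (u i) w * T m (k + 1) i w :=
    fun m k i w hw => pd_snd_iterDer (hu0 i w hw) _ k
  have hT0 : ∀ m k i, k < m → T m k i z = 0 := by
    intro m k i hk
    obtain ⟨G, _, _, hG⟩ := iterDer_pow_eq hVo (huV.1.smooth i) (hu0 i) (hv i) hzV (hv0 i) (hvy i)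
      m k hk.le
    rw [hT]
    simp only [hG z hzV, hv0, zero_pow (Nat.sub_ne_zero_of_lt hk), zero_mul]
  have hT1 : ∀ m i, T m m i z ≠ 0 := by
    intro m i
    obtain ⟨G, _, hG0, hG⟩ := iterDer_pow_eq hVo (huV.1.smooth i) (hu0 i) (hv i) hzV (hv0 i) (hvy i)
      m m le_rfl
    rw [hT]
    simp only [hG z hzV, Nat.sub_self, pow_zero, one_mul]
    exact hG0
  have hrel : ∀ (m : ℕ) (c : Fin d → 𝕜), 0 < m → (∀ e < m + 1, ∑ j, c j * l j ^ e = 0) →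
      IsAbelianRelation V u (fun k i w => c i * T m k i w) := by
    intro m c hm hc
    refine ⟨fun k i => contDiffOn_const.mul (hTs m k i), fun k i w hw => ?_, fun k i w hw => ?_,
      fun w hw => ?_⟩
    · rw [pd_const_mul _ _ (dT m k i w hw), hTx m k i w hw]
      ring
    · rw [pd_const_mul _ _ (dT m k i w hw), hTy m k i w hw]
      ring
    -- `v_i^m` is the value at `l_i` of the polynomial `(t - s X)^m`, of degree at most `m`.
    · have := sum_mul_eval_eq_zero hc
        ((Polynomial.C (t w) - Polynomial.C (s w) * Polynomial.X) ^ m) (by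
          refine Nat.lt_succ_of_le (Polynomial.natDegree_pow_le.trans ?_)
          refine (Nat.mul_le_mul_left m (?_ : _ ≤ 1)).trans (mul_one m).le
          compute_degree)
      rw [← this]
      refine Finset.sum_congr rfl fun j _ => ?_
      simp only [T, v, iterDer, Polynomial.eval_pow, Polynomial.eval_sub, Polynomial.eval_mul,
        Polynomial.eval_C, Polynomial.eval_X]
      rw [mul_comm (s w)]
  -- Descending induction on the level: the relation of degree `p.1.1 + 1` has a jet at `z` that
  -- vanishes below the level of `p`, has `p` as its only nonzero free coordinate there, and meets
  -- known zero rows above.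
  have key : ∀ n, ∀ p : FreeIdx d, d - 2 - (p.1.1 : ℕ) ≤ n → ∀ q, curvature u z p q = 0 := by
    intro n
    induction n with
    | zero => intro p hp; have := p.1.1.2; omega
    | succ n ih =>
      intro p hp q
      have hp2 := p.2
      push Not at hp2
      obtain ⟨c, hc1, hc0, hc⟩ := exists_moments_eq_zero hl p.1.2 hp2
      have hW := hrel ((p.1.1 : ℕ) + 1) c (Nat.succ_pos _) hc
      have hsum := hW.sum_mul_curvature hd hl hVo huV hRV hzV q
      rw [Finset.sum_eq_single p] at hsum
      · refine (mul_eq_zero.1 hsum).resolve_left ?_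
        simp only [jet, hc1, one_mul]
        exact hT1 _ _
      · intro p' _ hpp'
        have hp2' := p'.2
        push Not at hp2'
        simp only [jet]
        rcases lt_trichotomy (p'.1.1 : ℕ) p.1.1 with hlt | heq | hgt
        · rw [hT0 _ _ _ (by omega), mul_zero, zero_mul]
        · have : p'.1.2 ≠ p.1.2 := fun e => hpp' (Subtype.ext (Prod.ext (Fin.ext heq) e))
          rw [hc0 _ (by omega) this, zero_mul, zero_mul]
        · rw [ih p' (by omega) q, mul_zero]
      · simp
  ext p q
  exact key _ p le_rfl q

/-- Local first integrals of a web whose slopes are proportional to a decomposable function. -/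
theorem MixedLogVanishes.exists_hasSlopes (hl : Function.Injective l) (hU : IsOpen U)
    (hRs : ContDiffOn 𝕜 ∞ R U) (hR : ∀ z ∈ U, R z ≠ 0) (h : MixedLogVanishes R U)
    {z : 𝕜 × 𝕜} (hz : z ∈ U) : ∃ V : Set (𝕜 × 𝕜), IsOpen V ∧ z ∈ V ∧ V ⊆ U ∧
      ∃ u : Fin d → 𝕜 × 𝕜 → 𝕜, HasSlopes (fun i z => R z * l i) V u := by
  obtain ⟨V, hVo, hzV, hVU, s, t, hs, ht, _, _, hst⟩ := h.exists_potentials hU hRs hR hz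
  have hv : ∀ i e, ∀ w ∈ V, pd e (fun w => t w - l i * s w) w = pd e t w - l i * pd e s w := by
    intro i e w hw
    have ds := ContDiffOn.differentiableAt_of_isOpen hVo hs hw
    rw [pd_sub e (ContDiffOn.differentiableAt_of_isOpen hVo ht hw) (ds.const_mul (l i)),
      pd_const_mul e _ ds]
  refine ⟨V, hVo, hzV, hVU, fun i w => t w - l i * s w,
    ⟨fun i => ht.sub (contDiffOn_const.mul hs), fun w hw i j hij => ?_⟩, fun w hw i => ?_⟩
  · obtain ⟨h1, h2, h3, h4⟩ := hst w hw
    simp only [pdx_eq_pd, pdy_eq_pd, hv _ _ w hw, h1, h2, h4]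
    have : (l j - l i) * (R w * pd (0, 1) t w * pd (0, 1) t w) ≠ 0 :=
      mul_ne_zero (sub_ne_zero.2 fun e => hij (hl e.symm))
        (mul_ne_zero (mul_ne_zero (hR w (hVU hw)) h3) h3)
    intro e
    exact this (by linear_combination e)
  · obtain ⟨h1, h2, _, h4⟩ := hst w hw
    simp only [pdx_eq_pd, pdy_eq_pd, hv _ _ w hw, h1, h2, h4]
    ring

end Flat

/-! ### Chain rule coefficients one below the top order -/

section SubTop

variable {U : Set (𝕜 × 𝕜)} {R g : 𝕜 × 𝕜 → 𝕜} {τ : 𝕜}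

theorem pd_fst_pd_snd_of_slope (hU : IsOpen U) (hR : ContDiffOn 𝕜 ∞ R U)
    (hg : ContDiffOn 𝕜 ∞ g U) (hgR : ∀ z ∈ U, pd (1, 0) g z = τ * R z * pd (0, 1) g z)
    {z : 𝕜 × 𝕜} (hz : z ∈ U) : pd (1, 0) (pd (0, 1) g) z =
      τ * (pd (0, 1) R z * pd (0, 1) g z + R z * pd (0, 1) (pd (0, 1) g) z) := by
  have dR := ContDiffOn.differentiableAt_of_isOpen hU hR hz
  have dg := ContDiffOn.differentiableAt_of_isOpen hU (contDiffOn_pd (0, 1) hU hg) hz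
  rw [pd_comm _ hU hg hz, pd_congr _ hU hgR hz, pd_mul _ (dR.const_mul τ) dg, pd_const_mul _ _ dR]
  ring

theorem pd_fst_pd_fst_of_slope (hU : IsOpen U) (hR : ContDiffOn 𝕜 ∞ R U)
    (hg : ContDiffOn 𝕜 ∞ g U) (hgR : ∀ z ∈ U, pd (1, 0) g z = τ * R z * pd (0, 1) g z)
    {z : 𝕜 × 𝕜} (hz : z ∈ U) : pd (1, 0) (pd (1, 0) g) z =
      τ * (pd (1, 0) R z * pd (0, 1) g z + R z * (pd (1, 0) (pd (0, 1) g) z)) := by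
  have dR := ContDiffOn.differentiableAt_of_isOpen hU hR hz
  have dg := ContDiffOn.differentiableAt_of_isOpen hU (contDiffOn_pd (0, 1) hU hg) hz
  rw [pd_congr _ hU hgR hz, pd_mul _ (dR.const_mul τ) dg, pd_const_mul _ _ dR]
  ring

theorem pd_chainCoeff_top (hU : IsOpen U) (hg : ContDiffOn 𝕜 ∞ g U) (e : 𝕜 × 𝕜)
    {A B n : ℕ} (hn : A + B = n) {z : 𝕜 × 𝕜} (hz : z ∈ U) :
    pd e (chainCoeff g A B n) z =
      A * pd (1, 0) g z ^ (A - 1) * pd e (pd (1, 0) g) z * pd (0, 1) g z ^ B +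
        pd (1, 0) g z ^ A * (B * pd (0, 1) g z ^ (B - 1) * pd e (pd (0, 1) g) z) := by
  have dx := ContDiffOn.differentiableAt_of_isOpen hU (contDiffOn_pd (1, 0) hU hg) hz
  have dy := ContDiffOn.differentiableAt_of_isOpen hU (contDiffOn_pd (0, 1) hU hg) hz
  rw [← hn, chainCoeff_top, pdx_eq_pd, pdy_eq_pd, pd_mul e (dx.fun_pow A) (dy.fun_pow B),
    pd_pow e dx, pd_pow e dy]

/-- The Faà di Bruno coefficient is `n (n + 1) / 2 * g_y^(n-1) * g_yy`; multiplication by `2 g_y`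
avoids the exponent `n - 1`. -/
theorem chainCoeff_zero_subtop (hU : IsOpen U) (hg : ContDiffOn 𝕜 ∞ g U) (n : ℕ)
    {z : 𝕜 × 𝕜} (hz : z ∈ U) : 2 * pd (0, 1) g z * chainCoeff g 0 (n + 1) n z =
      (n + 1) * n * pd (0, 1) g z ^ n * pd (0, 1) (pd (0, 1) g) z := by
  induction n with
  | zero => rw [chainCoeff_zero_right _ _ _ (by omega)]; simp
  | succ n ih =>
    simp only [chainCoeff_zero_succ_succ g (n + 1) n]
    rw [pd_chainCoeff_top hU hg _ (zero_add _) hz, Nat.add_sub_cancel]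
    push_cast
    linear_combination (pd (0, 1) g z) * ih

/-- Induction on the number of `x`-derivatives, each removed from `g` by `g_x = τ R g_y`. The factor
`2 g_y R` keeps the identity polynomial. -/
theorem chainCoeff_succ_subtop (hU : IsOpen U) (hR : ContDiffOn 𝕜 ∞ R U)
    (hg : ContDiffOn 𝕜 ∞ g U) (hgR : ∀ z ∈ U, pd (1, 0) g z = τ * R z * pd (0, 1) g z)
    {z : 𝕜 × 𝕜} (hz : z ∈ U) (A B : ℕ) :
    2 * pd (0, 1) g z * R z * chainCoeff g (A + 1) B (A + B) z =
      pd (0, 1) g z ^ (A + B) * R z ^ A * (((A : 𝕜) + B + 1) * (A + B) *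
        pd (0, 1) (pd (0, 1) g) z * R z ^ 2 * τ ^ (A + 1) + pd (0, 1) g z *
        ((2 * ((A : 𝕜) + B + 1) * (A + 1) - (A + 1) * (A + 2)) * R z * pd (0, 1) R z * τ ^ (A + 1) +
          (A + 1) * A * τ ^ A * pd (1, 0) R z)) := by
  have hB : ∀ B : ℕ, pd (0, 1) g z * (B * pd (0, 1) g z ^ (B - 1)) = B * pd (0, 1) g z ^ B := by
    intro B
    cases B with
    | zero => simp
    | succ B => rw [Nat.add_sub_cancel, pow_succ]; ring
  induction A with
  | zero =>
    cases B with
    | zero => rw [chainCoeff_zero_right _ _ _ (by omega)]; simp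
    | succ n =>
      have h0 := chainCoeff_zero_subtop hU hg n hz
      rw [show 0 + (n + 1) = n + 1 by omega]
      simp only [chainCoeff_succ_succ g 0 (n + 1) n]
      rw [pd_chainCoeff_top hU hg _ (zero_add _) hz, Nat.add_sub_cancel,
        pd_fst_pd_snd_of_slope hU hR hg hgR hz, hgR z hz]
      push_cast
      linear_combination (R z * (τ * R z * pd (0, 1) g z)) * h0
  | succ A ih =>
    rw [show A + 1 + B = A + B + 1 by omega]
    simp only [chainCoeff_succ_succ g (A + 1) B (A + B)]
    rw [pd_chainCoeff_top hU hg _ (by omega) hz, Nat.add_sub_cancel,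
      pd_fst_pd_fst_of_slope hU hR hg hgR hz, pd_fst_pd_snd_of_slope hU hR hg hgR hz, hgR z hz]
    push_cast
    linear_combination (τ * R z * pd (0, 1) g z) * ih + (2 * R z * (τ * R z * pd (0, 1) g z) ^ (A + 1)
      * τ * (pd (0, 1) R z * pd (0, 1) g z + R z * pd (0, 1) (pd (0, 1) g) z)) * hB B

/-- The coefficient of order one below the top. -/
theorem chainCoeff_subtop (hU : IsOpen U) (hR : ContDiffOn 𝕜 ∞ R U)
    (hg : ContDiffOn 𝕜 ∞ g U) (hgR : ∀ z ∈ U, pd (1, 0) g z = τ * R z * pd (0, 1) g z)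
    {z : 𝕜 × 𝕜} (hz : z ∈ U) (hR0 : R z ≠ 0) (hg0 : pd (0, 1) g z ≠ 0) {A B n : ℕ}
    (hn : A + B = n + 1) :
    2 * chainCoeff g A B n z = pd (0, 1) g z ^ n * R z ^ A * ((n + 1) * n *
      (pd (0, 1) (pd (0, 1) g) z / pd (0, 1) g z) * τ ^ A +
        ((2 * (n + 1) * A - A * (A + 1)) * (pd (0, 1) R z / R z) * τ ^ A +
          A * (A - 1) * τ ^ (A - 1) * (pd (1, 0) R z / R z ^ 2))) := by
  cases A with
  | zero =>
    obtain rfl : B = n + 1 := by omega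
    have h := chainCoeff_zero_subtop hU hg n hz
    refine mul_left_cancel₀ hg0 ?_
    rw [← mul_assoc, mul_comm (pd (0, 1) g z), h]
    push_cast
    field_simp
    ring
  | succ A =>
    obtain rfl : n = A + B := by omega
    have h := chainCoeff_succ_subtop hU hR hg hgR hz A B
    refine mul_left_cancel₀ (mul_ne_zero hg0 hR0) ?_
    rw [← mul_assoc, mul_comm (_ * R z), ← mul_assoc, h, Nat.add_sub_cancel]
    push_cast
    field_simp
    ring

/-- The moments of `ξ` of order at most `n` vanish, so the `σ` terms disappear, and the coefficient
of `ρ` matters only at `A = n + 1`, where it is `(n + 1) n`. It may be replaced by this constant,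
after which Vandermonde uniqueness applies to `n + 2` unknowns. -/
theorem subtop_moments {l : Fin d → 𝕜} (hl : Function.Injective l) {ξ η κ : Fin d → 𝕜} {ρ σ : 𝕜}
    {n : ℕ} (hξ : ∀ e < n + 1, ∑ j, ξ j * l j ^ e = 0)
    (hξ0 : ∀ j : Fin d, n + 2 ≤ j → ξ j = 0) (hη0 : ∀ j : Fin d, n + 2 ≤ j → η j = 0)
    (h : ∀ A < n + 2, ∑ j, (2 * η j * l j ^ A + ξ j * ((n + 1) * n * κ j * l j ^ A +
      ((2 * (n + 1) * A - A * (A + 1)) * ρ * l j ^ A + A * (A - 1) * l j ^ (A - 1) * σ))) = 0)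
    (i : Fin d) : 2 * η i + (n + 1) * n * ξ i * (κ i + ρ) = 0 := by
  refine eq_zero_of_moments (w := fun j => 2 * η j + (n + 1) * n * ξ j * (κ j + ρ)) (n := n + 2) hl
    (fun j hj => by rw [hξ0 j hj, hη0 j hj]; ring) (fun A hA => ?_) i
  have h1 : ((n + 1) * n - (2 * (n + 1) * A - A * (A + 1)) : 𝕜) * ∑ j, ξ j * l j ^ A = 0 := by
    rcases Nat.lt_or_ge A (n + 1) with hA' | hA'
    · rw [hξ A hA', mul_zero]
    · obtain rfl : A = n + 1 := by omega
      push_cast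
      ring
  have h2 : (A * (A - 1) : 𝕜) * ∑ j, ξ j * l j ^ (A - 1) = 0 := by
    cases A with
    | zero => simp
    | succ A => rw [Nat.add_sub_cancel, hξ A (by omega), mul_zero]
  rw [Finset.mul_sum] at h1 h2
  have h3 := h A hA
  have h4 : ∑ j, (2 * η j + (n + 1) * n * ξ j * (κ j + ρ)) * l j ^ A =
      ∑ j, (2 * η j * l j ^ A + ξ j * ((n + 1) * n * κ j * l j ^ A +
      ((2 * (n + 1) * A - A * (A + 1)) * ρ * l j ^ A + A * (A - 1) * l j ^ (A - 1) * σ))) +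
      ρ * ∑ j, ((n + 1) * n - (2 * (n + 1) * A - A * (A + 1)) : 𝕜) * (ξ j * l j ^ A) -
      σ * ∑ j, (A * (A - 1) : 𝕜) * (ξ j * l j ^ (A - 1)) := by
    rw [Finset.mul_sum, Finset.mul_sum, ← Finset.sum_add_distrib, ← Finset.sum_sub_distrib]
    exact Finset.sum_congr rfl fun j _ => by ring
  rw [h4, h1, h2, h3]
  ring

end SubTop

/-! ### The trace of the curvature -/

section Trace

variable {U : Set (𝕜 × 𝕜)} {R : 𝕜 × 𝕜 → 𝕜} {l : Fin d → 𝕜} {u : Fin d → 𝕜 × 𝕜 → 𝕜}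

/-- The derivatives of order `r + 2` of the relation, when the coordinates below the level `r`
vanish. -/
theorem prolong_eq_of_forall_lt_succ (u : Fin d → 𝕜 × 𝕜 → 𝕜) (z : 𝕜 × 𝕜) {a b : ℕ}
    {w : Idx d → 𝕜} (r : Fin (d - 2)) (hab : a + b = r + 2) (hw : ∀ s < r, ∀ j, w (s, j) = 0) :
    prolong u z a b w = (∑ j, chainCoeff (u j) a b (r + 1) z * w (r, j)) +
      if h : (r : ℕ) + 1 < d - 2 then
        ∑ j, pd (1, 0) (u j) z ^ a * pd (0, 1) (u j) z ^ b * w (⟨r + 1, h⟩, j) else 0 := by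
  have hzero : ∀ s : Fin (d - 2), s ≠ r → (s : ℕ) ≠ r + 1 →
      ∑ j, chainCoeff (u j) a b ((s : ℕ) + 1) z * w (s, j) = 0 := by
    intro s hs hs'
    refine Finset.sum_eq_zero fun j _ => ?_
    rcases lt_or_gt_of_ne hs with h | h
    · rw [hw s h, mul_zero]
    · rw [chainCoeff_of_lt _ _ _ _ (by have : (r : ℕ) < s := h; omega), zero_mul]
  rw [prolong]
  split_ifs with h
  · rw [Finset.sum_eq_add r ⟨r + 1, h⟩ (fun e => by simpa using congrArg Fin.val e)
      (fun s _ hs => hzero s hs.1 fun e => hs.2 (Fin.ext e)) (by simp) (by simp)]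
    congr 1
    refine Finset.sum_congr rfl fun j _ => ?_
    have h4 := congrFun (chainCoeff_top (u j) a b) z
    rw [hab] at h4
    rw [h4]
    rfl
  · rw [Finset.sum_eq_single r (fun s _ hs => hzero s hs (by omega)) (by simp), add_zero]

/-- The diagonal entries of `Δ` in the basis `kerBasis`. -/
theorem HasSlopes.matDelta_mulVec_kerBasis_self (hd : 3 ≤ d) (hl : Function.Injective l)
    (hU : IsOpen U) (hRs : ContDiffOn 𝕜 ∞ R U) (hR : ∀ z ∈ U, R z ≠ 0)
    (hu : HasSlopes (fun i z => R z * l i) U u) {z : 𝕜 × 𝕜} (hz : z ∈ U) (p : FreeIdx d) :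
    pd (0, 1) (u p.1.2) z * (matDelta u z *ᵥ kerBasis u z p) p.1 =
      -(((if (p.1.2 : ℕ) = p.1.1 + 2 then (p.1.1 + 2) * (p.1.1 + 1) else 0 : ℕ) : 𝕜) / 2 *
        (pd (0, 1) (pd (0, 1) (u p.1.2)) z / pd (0, 1) (u p.1.2) z + pd (0, 1) R z / R z)) := by
  obtain ⟨⟨r, i⟩, hp⟩ := p
  set p : FreeIdx d := ⟨(r, i), hp⟩ with hpdef
  have hp' : (r : ℕ) + 2 ≤ i := by simpa using hp
  obtain ⟨hker, hfree⟩ := hu.matMM_mulVec_kerBasis hd hl hz (hR z hz) p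
  set w := kerBasis u z p with hw
  have hlow : ∀ s < r, ∀ j, w (s, j) = 0 := by
    refine fun s hs => hu.eq_zero_of_mem_ker hd hl hz (hR z hz) hker (n := r) (fun q hq => ?_) s hs
    rw [hfree, if_neg]
    rintro rfl
    exact lt_irrefl _ hq
  have hy0 : ∀ j : Fin d, (r : ℕ) + 3 ≤ j → (matDelta u z *ᵥ w) (r, j) = 0 := by
    intro j hj
    -- The bound `r + 3 ≤ j < d` excludes the last level; so `Δ w` is a free coordinate of `w` at
    -- level `r + 1`.
    have hr : (r : ℕ) + 1 < d - 2 := by omega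
    rw [matDelta_mulVec_of_lt _ _ _ _ hr]
    have := hfree ⟨(⟨r + 1, hr⟩, j), by simp; omega⟩
    rw [this, if_neg]
    intro e
    have := congrArg (fun q : FreeIdx d => (q.1.1 : ℕ)) e
    simp [hpdef] at this
  by_cases hi : (i : ℕ) = r + 2
  swap
  · change _ * (matDelta u z *ᵥ w) (r, i) = _
    rw [hy0 i (by omega)]
    simp [hpdef, hi]
  have hx0 : ∀ j : Fin d, (r : ℕ) + 3 ≤ j → w (r, j) = 0 := by
    intro j hj
    rw [hfree ⟨(r, j), by simp; omega⟩, if_neg]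
    intro e
    have := congrArg (fun q : FreeIdx d => (q.1.2 : ℕ)) e
    simp only [hpdef] at this
    omega
  have hx1 : w (r, i) = 1 := by
    have := hfree p
    rwa [if_pos rfl] at this
  have hmom : ∀ e < (r : ℕ) + 1 + 1,
      ∑ j, (pd (0, 1) (u j) z ^ ((r : ℕ) + 1) * w (r, j)) * (-l j) ^ e = 0 := by
    intro e he
    have h1 := congrFun hker ⟨(r, ⟨r + 1 - e, by omega⟩), by simp; omega⟩
    rw [matMM_mulVec, prolong_eq_of_forall_lt u z r (by simp) hlow] at h1
    simp only [Pi.zero_apply] at h1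
    rw [show (r : ℕ) + 1 - (r + 1 - e) = e by omega, hu.sum_pow_mul_pow hz,
      show e + ((r : ℕ) + 1 - e) = r + 1 by omega] at h1
    have h2 := (mul_eq_zero.1 h1).resolve_left (pow_ne_zero _ (neg_ne_zero.2 (hR z hz)))
    have h3 := congrArg (fun t => (-1 : 𝕜) ^ e * t) h2
    simp only [mul_zero, Finset.mul_sum] at h3
    refine Eq.trans (Finset.sum_congr rfl fun j _ => ?_) h3
    rw [neg_pow (l j)]
    ring
  -- The same equations of order `r + 2` come from a row of `MM` below the last level and from the
  -- elimination of `ω^(d-1)` at the last level.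
  have hrow : ∀ a b : ℕ, a + b = r + 2 →
      ∑ j, (pd (1, 0) (u j) z ^ a * pd (0, 1) (u j) z ^ b * (matDelta u z *ᵥ w) (r, j) +
        chainCoeff (u j) a b (r + 1) z * w (r, j)) = 0 := by
    intro a b hab
    rw [Finset.sum_add_distrib, add_comm]
    have hpro := prolong_eq_of_forall_lt_succ u z r hab hlow
    by_cases hr : (r : ℕ) + 1 < d - 2
    · have h1 := congrFun hker ⟨(⟨r + 1, hr⟩, ⟨b, by omega⟩), by simp; omega⟩
      rw [matMM_mulVec] at h1
      simp only [Pi.zero_apply] at h1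
      rw [show (r : ℕ) + 1 + 1 - b = a by omega, hpro, dif_pos hr] at h1
      refine Eq.trans ?_ h1
      congr 1
      exact Finset.sum_congr rfl fun j _ => by rw [matDelta_mulVec_of_lt _ _ _ _ hr]
    · rw [dif_neg hr, add_zero] at hpro
      have h1 := hu.blockP_mulVec_matDelta hd hl hz (hR z hz) w r hr (a := b) (by omega)
      rw [show d - 1 - b = a by omega, hpro, add_comm] at h1
      exact h1
  have hne : ∀ j, pd (0, 1) (u j) z ≠ 0 := fun j => hu.pd_snd_ne_zero hd hz j
  have key := subtop_moments (n := r + 1) (l := fun j => -l j)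
    (fun a b e => hl (neg_injective e))
    (ξ := fun j => pd (0, 1) (u j) z ^ ((r : ℕ) + 1) * w (r, j))
    (η := fun j => pd (0, 1) (u j) z ^ ((r : ℕ) + 2) * (matDelta u z *ᵥ w) (r, j))
    (κ := fun j => pd (0, 1) (pd (0, 1) (u j)) z / pd (0, 1) (u j) z)
    (ρ := pd (0, 1) R z / R z) (σ := pd (1, 0) R z / R z ^ 2) hmom
    (fun j hj => by rw [hx0 j hj, mul_zero]) (fun j hj => by rw [hy0 j hj, mul_zero])
    (fun A hA => by
      obtain ⟨B, hB⟩ : ∃ B, A + B = r + 2 := ⟨r + 2 - A, by omega⟩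
      have h1 := hrow A B hB
      have h3 := congrArg (fun t => (2 : 𝕜) * t) h1
      simp only [mul_zero, Finset.mul_sum] at h3
      refine (mul_eq_zero.1 (Eq.trans ?_ h3)).resolve_left (pow_ne_zero A (hR z hz))
      rw [Finset.mul_sum]
      refine Finset.sum_congr rfl fun j _ => ?_
      have h2 := chainCoeff_subtop hU hRs (hu.1.smooth j) (τ := -l j) (fun z hz => hu.pd_fst hz j)
        hz (hR z hz) (hne j) (n := r + 1) hB
      rw [hu.pd_fst hz j, ← hB, pow_add]
      linear_combination (-w (r, j)) * h2) i
  simp only [hx1] at key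
  change _ * (matDelta u z *ᵥ w) (r, i) = _
  simp only [hpdef, hi, if_true]
  have hcancel : pd (0, 1) (u i) z ^ ((r : ℕ) + 1) ≠ 0 := pow_ne_zero _ (hne i)
  refine mul_left_cancel₀ hcancel ?_
  push_cast at key ⊢
  linear_combination key / 2

/-- Twice the number of the `3`-subwebs. -/
def traceCoeff (d : ℕ) : ℕ :=
  ∑ p : FreeIdx d, if (p.1.2 : ℕ) = p.1.1 + 2 then (p.1.1 + 2) * (p.1.1 + 1) else 0

theorem traceCoeff_pos (hd : 3 ≤ d) : 0 < traceCoeff d := by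
  refine Finset.sum_pos' (fun _ _ => Nat.zero_le _)
    ⟨⟨(⟨0, by omega⟩, ⟨2, by omega⟩), by simp⟩, Finset.mem_univ _, by simp⟩

/-- The trace of the curvature is a multiple of `∂_x ∂_y (log R)`. -/
theorem HasSlopes.trace_curvature (hd : 3 ≤ d) (hl : Function.Injective l) (hU : IsOpen U)
    (hRs : ContDiffOn 𝕜 ∞ R U) (hR : ∀ z ∈ U, R z ≠ 0)
    (hu : HasSlopes (fun i z => R z * l i) U u) {z : 𝕜 × 𝕜} (hz : z ∈ U) :
    (curvature u z).trace =
      -((traceCoeff d : 𝕜) / 2 * pd (1, 0) (fun w => pd (0, 1) R w / R w) z) := by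
  have hdiag : ∀ p : FreeIdx d, pd (0, 1) (fun w => omegaX u w p p) z -
      pd (1, 0) (fun w => omegaY u w p p) z =
      -(((if (p.1.2 : ℕ) = p.1.1 + 2 then (p.1.1 + 2) * (p.1.1 + 1) else 0 : ℕ) : 𝕜) / 2 *
        pd (1, 0) (fun w => pd (0, 1) R w / R w) z) := by
    intro p
    set c : 𝕜 := ((if (p.1.2 : ℕ) = p.1.1 + 2 then (p.1.1 + 2) * (p.1.1 + 1) else 0 : ℕ) : 𝕜) / 2
    set g := u p.1.2 with hgdef
    set a := pd (0, 1) g with hadef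
    have ha0 : ∀ w ∈ U, a w ≠ 0 := fun w hw => hu.pd_snd_ne_zero hd hw p.1.2
    have ha : ContDiffOn 𝕜 ∞ a U := contDiffOn_pd _ hU (hu.1.smooth _)
    have hY : Set.EqOn (fun w => omegaY u w p p)
        (fun w => c * (pd (0, 1) a w / a w + pd (0, 1) R w / R w)) U := by
      intro w hw
      simp only [omegaY_apply]
      rw [hu.matDelta_mulVec_kerBasis_self hd hl hU hRs hR hw p, neg_neg]
    -- With `a = ∂_y u_i`, the entries are `c (log a)_x` here and `c (log a + log R)_y` in `hY`. The
    -- mixed derivatives of `log a` cancel, whatever the first integral.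
    have hX : Set.EqOn (fun w => omegaX u w p p) (fun w => c * (pd (1, 0) a w / a w)) U := by
      intro w hw
      simp only [omegaX_apply]
      rw [hu.pd_fst hw, mul_assoc, hu.matDelta_mulVec_kerBasis_self hd hl hU hRs hR hw p, hadef,
        pd_fst_pd_snd_of_slope hU hRs (hu.1.smooth _) (fun z hz => hu.pd_fst hz p.1.2) hw]
      change -(_ * -(c * (pd (0, 1) a w / a w + _))) = c * (_ * (_ * a w + _ * pd (0, 1) a w) / a w)
      have h1 := ha0 w hw
      have h2 := hR w hw
      field_simp
      ring
    have da : DifferentiableAt 𝕜 a z := ContDiffOn.differentiableAt_of_isOpen hU ha hz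
    have da' : ∀ e, DifferentiableAt 𝕜 (pd e a) z := fun e =>
      ContDiffOn.differentiableAt_of_isOpen hU (contDiffOn_pd e hU ha) hz
    have dq : ∀ e, DifferentiableAt 𝕜 (fun w => pd e a w / a w) z := fun e =>
      ContDiffOn.differentiableAt_of_isOpen hU ((contDiffOn_pd e hU ha).div ha ha0) hz
    have dρ : DifferentiableAt 𝕜 (fun w => pd (0, 1) R w / R w) z :=
      ContDiffOn.differentiableAt_of_isOpen hU ((contDiffOn_pd _ hU hRs).div hRs hR) hz
    rw [pd_congr _ hU hX hz, pd_congr _ hU hY hz, pd_const_mul _ _ (dq _),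
      pd_const_mul _ _ ((dq _).fun_add dρ), pd_add _ (dq _) dρ, pd_div _ (da' _) da (ha0 z hz),
      pd_div _ (da' _) da (ha0 z hz), pd_comm (0, 1) hU ha hz]
    ring
  have htr : (omegaX u z * omegaY u z - omegaY u z * omegaX u z).trace = 0 := by
    rw [Matrix.trace_sub, Matrix.trace_mul_comm, sub_self]
  rw [curvature, Matrix.trace_add, htr, add_zero, Matrix.trace]
  simp only [Matrix.diag_apply, Matrix.of_apply]
  rw [pdx_eq_pd, pdy_eq_pd, Finset.sum_congr rfl fun p _ => hdiag p, Finset.sum_neg_distrib,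
    ← Finset.sum_mul, ← Finset.sum_div, traceCoeff, Nat.cast_sum]

/-- The curvature of a web of slopes `R l_i` vanishes if and only if `∂_x ∂_y (log R) = 0`. -/
theorem HasSlopes.curvature_eq_zero_iff (hd : 3 ≤ d) (hl : Function.Injective l) (hU : IsOpen U)
    (hRs : ContDiffOn 𝕜 ∞ R U) (hR : ∀ z ∈ U, R z ≠ 0)
    (hu : HasSlopes (fun i z => R z * l i) U u) :
    (∀ z ∈ U, curvature u z = 0) ↔ MixedLogVanishes R U := by
  refine ⟨fun h z hz => ?_, fun h z hz => hu.curvature_eq_zero hd hl hU hRs hR h hz⟩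
  have h1 := hu.trace_curvature hd hl hU hRs hR hz
  rw [h z hz, Matrix.trace_zero, eq_comm, neg_eq_zero] at h1
  have h2 : (traceCoeff d : 𝕜) / 2 ≠ 0 :=
    div_ne_zero (Nat.cast_ne_zero.2 (traceCoeff_pos hd).ne') two_ne_zero
  exact (pd_logDeriv_snd hU hRs hz (hR z hz)).1 ((mul_eq_zero.1 h1).resolve_left h2)

end Trace

/-! ### From prescribed slopes to the implicit equation -/

section Slopes

variable {U : Set (𝕜 × 𝕜)} {R : 𝕜 × 𝕜 → 𝕜} {l : Fin d → 𝕜}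

/-- Flatness includes the existence of local first integrals; for the converse these are the
functions `t - l_i s`. -/
theorem isFlat_hasSlopes_iff (hd : 3 ≤ d) (hl : Function.Injective l) (hU : IsOpen U)
    (hRs : ContDiffOn 𝕜 ∞ R U) (hR : ∀ z ∈ U, R z ≠ 0) :
    IsFlat (HasSlopes fun i z => R z * l i) U ↔ MixedLogVanishes R U := by
  refine ⟨fun h z hz => ?_, fun h z hz => ?_⟩
  · obtain ⟨V, hVo, hzV, hVU, u, hu, hK⟩ := h z hz
    exact (hu.curvature_eq_zero_iff hd hl hVo (hRs.mono hVU) fun w hw => hR w (hVU hw)).1 hK z hzV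
  · obtain ⟨V, hVo, hzV, hVU, u, hu⟩ := h.exists_hasSlopes hl hU hRs hR hz
    exact ⟨V, hVo, hzV, hVU, u, hu, fun w hw => hu.curvature_eq_zero hd hl hVo (hRs.mono hVU)
      (fun w hw => hR w (hVU hw)) (fun w hw => h w (hVU hw)) hw⟩

/-- The slopes of a web given by an implicit differential equation. -/
theorem SolvesImplicit.exists_slopes {F : 𝕜 × 𝕜 → Polynomial 𝕜} {u : Fin d → 𝕜 × 𝕜 → 𝕜}
    (hu : SolvesImplicit F U u) : ∃ m : Fin d → 𝕜 × 𝕜 → 𝕜, HasSlopes m U u ∧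
      ∀ z ∈ U, ∀ i, (F z).IsRoot (m i z) := by
  choose! m hm using hu.2
  exact ⟨fun i z => m z i, ⟨hu.1, fun z hz i => (hm z hz i).2⟩, fun z hz i => (hm z hz i).1⟩

theorem HasSlopes.contDiffOn (hd : 3 ≤ d) (hU : IsOpen U) {m : Fin d → 𝕜 × 𝕜 → 𝕜}
    {u : Fin d → 𝕜 × 𝕜 → 𝕜} (hu : HasSlopes m U u) (i : Fin d) : ContDiffOn 𝕜 ∞ (m i) U := by
  refine ((contDiffOn_pd (1, 0) hU (hu.1.smooth i)).div (contDiffOn_pd (0, 1) hU (hu.1.smooth i))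
    fun z hz => hu.pd_snd_ne_zero hd hz i).neg.congr fun z hz => ?_
  have h1 : pd (1, 0) (u i) z + m i z * pd (0, 1) (u i) z = 0 := hu.2 z hz i
  have h2 := hu.pd_snd_ne_zero hd hz i
  rw [Pi.div_apply, ← neg_div, eq_div_iff h2]
  linear_combination h1

theorem HasSlopes.injective {m : Fin d → 𝕜 × 𝕜 → 𝕜} {u : Fin d → 𝕜 × 𝕜 → 𝕜}
    (hu : HasSlopes m U u) {z : 𝕜 × 𝕜} (hz : z ∈ U) : Function.Injective fun i => m i z := by
  intro i j hij
  by_contra hne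
  refine hu.1.transverse z hz i j hne ?_
  have h1 := hu.2 z hz i
  have h2 := hu.2 z hz j
  simp only at hij
  rw [← hij] at h2
  linear_combination (pdy (u j) z) * h1 - (pdy (u i) z) * h2

theorem finite_pow_eq_one (hd : 0 < d) : {x : 𝕜 | x ^ d = 1}.Finite := by
  refine (Polynomial.nthRootsFinset d (1 : 𝕜)).finite_toSet.subset fun x hx => ?_
  exact (Polynomial.mem_nthRootsFinset hd 1).2 hx

/-- Near each point, a web given by `(y')^d + f = 0` has slopes proportional to constants. -/
theorem SolvesImplicit.exists_hasSlopes (hd : 3 ≤ d) (hU : IsOpen U) {f : 𝕜 × 𝕜 → 𝕜}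
    (hf : ∀ z ∈ U, f z ≠ 0) {u : Fin d → 𝕜 × 𝕜 → 𝕜}
    (hu : SolvesImplicit (fun z => Polynomial.X ^ d + Polynomial.C (f z)) U u) {z₀ : 𝕜 × 𝕜}
    (hz₀ : z₀ ∈ U) : ∃ V : Set (𝕜 × 𝕜), IsOpen V ∧ z₀ ∈ V ∧ V ⊆ U ∧ ∃ (R : 𝕜 × 𝕜 → 𝕜)
      (l : Fin d → 𝕜), Function.Injective l ∧ ContDiffOn 𝕜 ∞ R V ∧ (∀ z ∈ V, R z ≠ 0) ∧
        (∀ z ∈ V, f z = -R z ^ d) ∧ HasSlopes (fun i z => R z * l i) V u := by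
  obtain ⟨m, hm, hroot⟩ := hu.exists_slopes
  have hpow : ∀ z ∈ U, ∀ i, m i z ^ d = -f z := by
    intro z hz i
    have := hroot z hz i
    simp only [Polynomial.IsRoot.def, Polynomial.eval_add, Polynomial.eval_pow, Polynomial.eval_X,
      Polynomial.eval_C] at this
    exact eq_neg_of_add_eq_zero_left this
  have hm0 : ∀ z ∈ U, ∀ i, m i z ≠ 0 := by
    intro z hz i h
    have := hpow z hz i
    rw [h, zero_pow (by omega), eq_comm, neg_eq_zero] at this
    exact hf z hz this
  set i₀ : Fin d := ⟨0, by omega⟩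
  -- A continuous function with values in the finite set of `d`-th roots of unity is locally
  -- constant.
  have hζ : ∀ i, ∀ᶠ z in 𝓝 z₀, m i z / m i₀ z = m i z₀ / m i₀ z₀ := by
    intro i
    have hc : ContinuousAt (fun z => m i z / m i₀ z) z₀ :=
      ((hm.contDiffOn hd hU i).div (hm.contDiffOn hd hU i₀) fun z hz =>
        hm0 z hz i₀).continuousOn.continuousAt (hU.mem_nhds hz₀)
    have hfin : ({x : 𝕜 | x ^ d = 1} \ {m i z₀ / m i₀ z₀}).Finite :=
      (finite_pow_eq_one (by omega)).sdiff
    have := hc.eventually (hfin.isClosed.isOpen_compl.mem_nhds (by simp))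
    filter_upwards [this, hU.mem_nhds hz₀] with z h1 hz
    by_contra hne
    refine h1 ⟨?_, hne⟩
    rw [Set.mem_ofPred_eq, div_pow, hpow z hz, hpow z hz, div_self (neg_ne_zero.2 (hf z hz))]
  obtain ⟨V, hV, hVo, hzV⟩ := mem_nhds_iff.1
    (Filter.inter_mem (hU.mem_nhds hz₀) (Filter.eventually_all.2 hζ))
  have hVU : V ⊆ U := fun z hz => (hV hz).1
  have hslope : ∀ z ∈ V, ∀ i, m i₀ z * (m i z₀ / m i₀ z₀) = m i z := by
    intro z hz i
    rw [← (hV hz).2 i, mul_div_cancel₀ _ (hm0 z (hVU hz) i₀)]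
  refine ⟨V, hVo, hzV, hVU, m i₀, fun i => m i z₀ / m i₀ z₀, fun i j hij => ?_,
    (hm.contDiffOn hd hU i₀).mono hVU, fun z hz => hm0 z (hVU hz) i₀, fun z hz => ?_,
    (hm.mono hVU).1, fun z hz i => ?_⟩
  · exact hm.injective hz₀ ((div_left_inj' (hm0 z₀ hz₀ i₀)).1 hij)
  · rw [hpow z (hVU hz), neg_neg]
  · change _ + m i₀ z * (m i z₀ / m i₀ z₀) * _ = 0
    rw [hslope z hz i]
    exact hm.2 z (hVU hz) i

theorem mixedLogVanishes_neg_pow_iff (hd : d ≠ 0) (hU : IsOpen U) {f : 𝕜 × 𝕜 → 𝕜}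
    (hRs : ContDiffOn 𝕜 ∞ R U) (hR : ∀ z ∈ U, R z ≠ 0) (hf : ∀ z ∈ U, f z = -R z ^ d) :
    MixedLogVanishes f U ↔ MixedLogVanishes R U := by
  have hfs : ContDiffOn 𝕜 ∞ f U := (hRs.pow d).neg.congr hf
  have hf0 : ∀ z ∈ U, f z ≠ 0 := fun z hz => by
    rw [hf z hz]
    exact neg_ne_zero.2 (pow_ne_zero d (hR z hz))
  have hlog : Set.EqOn (fun w => pd (0, 1) f w / f w)
      (fun w => (d : 𝕜) * (pd (0, 1) R w / R w)) U := by
    intro z hz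
    have h1 := hR z hz
    simp only
    rw [pd_congr _ hU hf hz, hf z hz, pd_neg,
      pd_pow _ (ContDiffOn.differentiableAt_of_isOpen hU hRs hz), neg_div_neg_eq]
    obtain ⟨n, rfl⟩ := Nat.exists_eq_succ_of_ne_zero hd
    rw [Nat.succ_eq_add_one, Nat.add_sub_cancel]
    field_simp
    ring
  refine forall₂_congr fun z hz => ?_
  have hd' : DifferentiableAt 𝕜 (fun w => pd (0, 1) R w / R w) z :=
    ContDiffOn.differentiableAt_of_isOpen hU ((contDiffOn_pd _ hU hRs).div hRs hR) hz
  rw [← pd_logDeriv_snd hU hfs hz (hf0 z hz), ← pd_logDeriv_snd hU hRs hz (hR z hz),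
    pd_congr _ hU hlog hz, pd_const_mul _ _ hd', mul_eq_zero, or_iff_right (Nat.cast_ne_zero.2 hd)]

/-- Both sides are local, and a slope of the web itself serves as the local root `R`, so neither
smoothness of `f` nor algebraic closedness is needed. -/
theorem SolvesImplicit.curvature_eq_zero_iff (hd : 3 ≤ d) (hU : IsOpen U) {f : 𝕜 × 𝕜 → 𝕜}
    (hf : ∀ z ∈ U, f z ≠ 0) {u : Fin d → 𝕜 × 𝕜 → 𝕜}
    (hu : SolvesImplicit (fun z => Polynomial.X ^ d + Polynomial.C (f z)) U u) :
    (∀ z ∈ U, curvature u z = 0) ↔ MixedLogVanishes f U := by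
  refine ⟨fun h z hz => ?_, fun h z hz => ?_⟩
  all_goals
    obtain ⟨V, hVo, hzV, hVU, R, l, hl, hRs, hR, hfR, hs⟩ := hu.exists_hasSlopes hd hU hf hz
    have h1 := hs.curvature_eq_zero_iff hd hl hVo hRs hR
    rw [← mixedLogVanishes_neg_pow_iff (by omega) hVo hRs hR hfR] at h1
  · exact h1.1 (fun w hw => h w (hVU hw)) z hzV
  · exact h1.2 (fun w hw => h w (hVU hw)) z hzV

end Slopes

/-! ### Existence of the implicit web over the complex numbers -/

section Complex

variable {U : Set (ℂ × ℂ)} {f : ℂ × ℂ → ℂ}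

/-- A holomorphic function without zeros has local `d`-th roots. -/
theorem exists_local_root (hd : d ≠ 0) (hU : IsOpen U) (hfs : ContDiffOn ℂ ∞ f U)
    (hf : ∀ z ∈ U, f z ≠ 0) {z₀ : ℂ × ℂ} (hz₀ : z₀ ∈ U) :
    ∃ V : Set (ℂ × ℂ), IsOpen V ∧ z₀ ∈ V ∧ V ⊆ U ∧ ∃ R : ℂ × ℂ → ℂ, ContDiffOn ℂ ∞ R V ∧
      (∀ z ∈ V, R z ≠ 0) ∧ ∀ z ∈ V, f z = -R z ^ d := by
  -- The quotient `f / f z₀` is `1` at `z₀`, so its principal logarithm is holomorphic nearby; the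
  -- constant `c` accounts for `-f z₀`.
  obtain ⟨c, hc⟩ := IsAlgClosed.exists_pow_nat_eq (-f z₀) (Nat.pos_of_ne_zero hd)
  have hq : ContDiffOn ℂ ∞ (fun z => f z / f z₀) U := hfs.div_const _
  have hVU : U ∩ (fun z => f z / f z₀) ⁻¹' Complex.slitPlane ⊆ U := Set.inter_subset_left
  have hpow : ∀ z ∈ U ∩ (fun z => f z / f z₀) ⁻¹' Complex.slitPlane,
      f z = -(c * Complex.exp (Complex.log (f z / f z₀) / d)) ^ d := by
    intro z hz
    have h0 := hf z₀ hz₀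
    rw [mul_pow, hc, ← Complex.exp_nat_mul, mul_div_cancel₀ _ (Nat.cast_ne_zero.2 hd),
      Complex.exp_log (div_ne_zero (hf z hz.1) h0), neg_mul, neg_neg, mul_div_cancel₀ _ h0]
  refine ⟨_, hq.continuousOn.isOpen_inter_preimage hU Complex.isOpen_slitPlane, ⟨hz₀, ?_⟩, hVU,
    fun z => c * Complex.exp (Complex.log (f z / f z₀) / d), ?_, fun z hz h => ?_, hpow⟩
  · simp [div_self (hf z₀ hz₀)]
  · refine contDiffOn_const.mul (Complex.contDiff_exp.comp_contDiffOn (ContDiffOn.div_const ?_ _))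
    intro z hz
    exact (Complex.contDiffAt_log hz.2).comp_contDiffWithinAt z (hq.mono hVU z hz)
  · refine hf z hz.1 ?_
    simp only at h
    rw [hpow z hz, h, zero_pow hd, neg_zero]

theorem exists_injective_pow_eq_one (hd : d ≠ 0) :
    ∃ l : Fin d → ℂ, Function.Injective l ∧ ∀ i, l i ^ d = 1 := by
  have h := Complex.isPrimitiveRoot_exp d hd
  refine ⟨fun i => Complex.exp (2 * Real.pi * Complex.I / d) ^ (i : ℕ), fun i j hij => ?_,
    fun i => ?_⟩
  · exact Fin.ext (h.pow_inj i.2 j.2 hij)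
  · rw [pow_right_comm, h.pow_eq_one, one_pow]

theorem isFlat_solvesImplicit_iff (hd : 3 ≤ d) (hU : IsOpen U) (hfs : ContDiffOn ℂ ∞ f U)
    (hf : ∀ z ∈ U, f z ≠ 0) :
    IsFlat (SolvesImplicit (d := d) fun z => Polynomial.X ^ d + Polynomial.C (f z)) U ↔
      MixedLogVanishes f U := by
  refine ⟨fun h z hz => ?_, fun h z hz => ?_⟩
  · obtain ⟨V, hVo, hzV, hVU, u, hu, hK⟩ := h z hz
    exact (hu.curvature_eq_zero_iff hd hVo fun w hw => hf w (hVU hw)).1 hK z hzV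
  · obtain ⟨V, hVo, hzV, hVU, R, hRs, hR, hfR⟩ :=
      exists_local_root (d := d) (by omega) hU hfs hf hz
    obtain ⟨l, hl, hl1⟩ := exists_injective_pow_eq_one (d := d) (by omega)
    have hRm : MixedLogVanishes R V :=
      (mixedLogVanishes_neg_pow_iff (by omega) hVo hRs hR hfR).1 fun w hw => h w (hVU hw)
    obtain ⟨V', hV'o, hzV', hV'V, u, hu⟩ := hRm.exists_hasSlopes hl hVo hRs hR hzV
    refine ⟨V', hV'o, hzV', hV'V.trans hVU, u, ⟨hu.1, fun w hw i => ⟨_, ?_, hu.2 w hw i⟩⟩,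
      fun w hw => hu.curvature_eq_zero hd hl hV'o (hRs.mono hV'V) (fun w hw => hR w (hV'V hw))
        (fun w hw => hRm w (hV'V hw)) hw⟩
    simp [mul_pow, hl1, hfR w (hV'V hw)]

end Complex

end PlanarWeb

theorem mainTheorem3 :
    (∀ (𝕜 : Type*) [RCLike 𝕜] (d : ℕ), 3 ≤ d →
      ∀ U : Set (𝕜 × 𝕜), IsOpen U →
      ∀ R : 𝕜 × 𝕜 → 𝕜, ContDiffOn 𝕜 ∞ R U → (∀ z ∈ U, R z ≠ 0) →
      ∀ l : Fin d → 𝕜, Function.Injective l →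
        (∀ u : Fin d → 𝕜 × 𝕜 → 𝕜, PlanarWeb.HasSlopes (fun i z => R z * l i) U u →
          ((∀ z ∈ U, PlanarWeb.curvature u z = 0) ↔ PlanarWeb.IsLocallyDecomposable R U)) ∧
        (PlanarWeb.IsFlat (PlanarWeb.HasSlopes fun i z => R z * l i) U ↔
          PlanarWeb.IsLocallyDecomposable R U) ∧
        (∀ I J : Set 𝕜, IsPreconnected I → IsPreconnected J → U = I ×ˢ J →
          (PlanarWeb.IsFlat (PlanarWeb.HasSlopes fun i z => R z * l i) U ↔
            PlanarWeb.IsDecomposable R U))) ∧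
    (∀ d : ℕ, 3 ≤ d →
      ∀ U : Set (ℂ × ℂ), IsOpen U →
      ∀ f : ℂ × ℂ → ℂ, ContDiffOn ℂ ∞ f U → (∀ z ∈ U, f z ≠ 0) →
        (∀ u : Fin d → ℂ × ℂ → ℂ,
          PlanarWeb.SolvesImplicit (fun z => Polynomial.X ^ d + Polynomial.C (f z)) U u →
          ((∀ z ∈ U, PlanarWeb.curvature u z = 0) ↔ PlanarWeb.IsLocallyDecomposable f U)) ∧
        (PlanarWeb.IsFlat
            (PlanarWeb.SolvesImplicit (d := d) fun z => Polynomial.X ^ d + Polynomial.C (f z)) U ↔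
          PlanarWeb.IsLocallyDecomposable f U) ∧
        (∀ I J : Set ℂ, IsPreconnected I → IsPreconnected J → U = I ×ˢ J →
          (PlanarWeb.IsFlat
              (PlanarWeb.SolvesImplicit (d := d) fun z => Polynomial.X ^ d + Polynomial.C (f z))
              U ↔
            PlanarWeb.IsDecomposable f U))) := by
  refine ⟨fun 𝕜 _ d hd U hU R hRs hR l hl => ?_, fun d hd U hU f hfs hf => ?_⟩
  · have h := PlanarWeb.isLocallyDecomposable_iff hU hRs hR
    have hflat := (PlanarWeb.isFlat_hasSlopes_iff hd hl hU hRs hR).trans h.symm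
    exact ⟨fun u hu => (hu.curvature_eq_zero_iff hd hl hU hRs hR).trans h.symm, hflat,
      fun I J hI hJ hIJ => hflat.trans
        (PlanarWeb.isDecomposable_iff_isLocallyDecomposable hU hRs hR hI hJ hIJ).symm⟩
  · have h := PlanarWeb.isLocallyDecomposable_iff hU hfs hf
    have hflat := (PlanarWeb.isFlat_solvesImplicit_iff hd hU hfs hf).trans h.symm
    exact ⟨fun u hu => (hu.curvature_eq_zero_iff hd hU hf).trans h.symm, hflat,
      fun I J hI hJ hIJ => hflat.trans
        (PlanarWeb.isDecomposable_iff_isLocallyDecomposable hU hfs hf hI hJ hIJ).symm⟩
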